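/- Let $p$ be a prime (including $p=2$), let $e\ge 1$ be an integer, put $R=\mathbb{Z}/p^e\mathbb{Z}$ and $G=\mathrm{GL}_2(R)$. If $p$ is odd, let $\xi\in R^\times$ be any non-square. Consider the following subgroups of $G$: $$C_{\mathrm s}=\left\{\begin{pmatrix}a&0\\0&d\end{pmatrix} : a,d\in R^\times\right\},$$ $$C_{\mathrm{ns}}=\left\{\begin{pmatrix}a&b\\b&a+b\end{pmatrix} : a,b\in R,\ (a,b)\not\equiv(0,0)\bmod 2\right\}\ \text{ if } p=2,$$ $$C_{\mathrm{ns}}=\left\{\begin{pmatrix}a&b\xi\\b&a\end{pmatrix} : a,b\in R,\ (a,b)\not\equiv(0,0)\bmod p\right\}\ \text{ if } p \text{ is odd},$$ and, for $r=0,1,\dots,e-1$, $$B_r=\left\{\begin{pmatrix}a&bp^r\\cp^{r+1}&d\end{pmatrix} : a,b,c,d\in R,\ ad\not\equiv0\bmod p\right\},$$ $$T_r=\left\{\begin{pmatrix}a&bp^r\\cp^r&d\end{pmatrix} : a,b,c,d\in R,\ ad-bcp^{2r}\in R^\times\right\}.$$ For a subgroup $H\le G$ let $\mathbb{Q}[G/H]$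 be the permutation representation of $G$ over $\mathbb{Q}$ attached to the left multiplication action on the cosets $gH$, and write $2V=V\oplus V$. Then there is an isomorphism of $\mathbb{Q}$-representations of $G$ $$\mathbb{Q}[G/C_{\mathrm{ns}}]\oplus\bigoplus_{r=0}^{e-1}2\,\mathbb{Q}[G/B_r]\;\cong\;\mathbb{Q}[G/C_{\mathrm s}]\oplus\bigoplus_{r=0}^{e-1}2\,\mathbb{Q}[G/T_r].$$ -/

import Mathlib

open scoped MonoidAlgebra DirectSum

namespace CartanChen

/-- The group `GL₂(ℤ/pᵉℤ)`. -/
abbrev G (p e : ℕ) : Type := GL (Fin 2) (ZMod (p ^ e))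

section helpers

variable {p e : ℕ} [Fact p.Prime] [NeZero e]

theorem not_isUnit_of_dvd {x : ZMod (p ^ e)} (h : (p : ZMod (p ^ e)) ∣ x) : ¬ IsUnit x := by
  intro hx
  have hu : IsUnit (p : ZMod (p ^ e)) := isUnit_of_dvd_unit h hx
  rw [ZMod.isUnit_iff_coprime] at hu
  have hp : p.Prime := Fact.out
  have h1 : p ∣ p ^ e := dvd_pow_self p (NeZero.ne e)
  have h2 : p ∣ Nat.gcd p (p ^ e) := Nat.dvd_gcd dvd_rfl h1
  rw [Nat.Coprime] at hu
  rw [hu] at h2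
  exact hp.one_lt.ne' (Nat.dvd_one.mp h2)

theorem not_dvd_det (g : G p e) :
    ¬ (p : ZMod (p ^ e)) ∣ (g : Matrix (Fin 2) (Fin 2) (ZMod (p ^ e))).det := fun h =>
  not_isUnit_of_dvd h ((Matrix.isUnit_iff_isUnit_det _).mp g.isUnit)

theorem coe_inv_of_eq {g : G p e} {x y z w : ZMod (p ^ e)}
    (h : (g : Matrix (Fin 2) (Fin 2) (ZMod (p ^ e))) = !![x, y; z, w]) :
    ∃ t : ZMod (p ^ e), ((g⁻¹ : G p e) : Matrix (Fin 2) (Fin 2) (ZMod (p ^ e))) =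
      !![t * w, t * (-y); t * (-z), t * x] := by
  refine ⟨Ring.inverse (g : Matrix (Fin 2) (Fin 2) (ZMod (p ^ e))).det, ?_⟩
  rw [Matrix.coe_units_inv, Matrix.inv_def]
  conv_lhs => rw [h, Matrix.adjugate_fin_two_of, ← h]
  ext i j
  fin_cases i <;> fin_cases j <;> simp

theorem cns_cond {ξ : ZMod (p ^ e)} {g : G p e} {a b : ZMod (p ^ e)}
    (h : (g : Matrix (Fin 2) (Fin 2) (ZMod (p ^ e))) =
      if p = 2 then !![a, b; b, a + b] else !![a, b * ξ; b, a]) :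
    ¬ ((p : ZMod (p ^ e)) ∣ a ∧ (p : ZMod (p ^ e)) ∣ b) := by
  rintro ⟨⟨x, hx⟩, ⟨y, hy⟩⟩
  apply not_dvd_det g
  rw [h]
  split_ifs
  · rw [Matrix.det_fin_two_of, hx, hy]
    exact ⟨x * (p * x + p * y) - y * (p * y), by ring⟩
  · rw [Matrix.det_fin_two_of, hx, hy]
    exact ⟨x * (p * x) - y * ξ * (p * y), by ring⟩

theorem b_cond {g : G p e} {a b c d : ZMod (p ^ e)} {r : ℕ}
    (h : (g : Matrix (Fin 2) (Fin 2) (ZMod (p ^ e))) =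
      !![a, b * (p : ZMod (p ^ e)) ^ r; c * (p : ZMod (p ^ e)) ^ (r + 1), d]) :
    ¬ (p : ZMod (p ^ e)) ∣ a * d := by
  intro hd
  apply not_dvd_det g
  rw [h, Matrix.det_fin_two_of]
  exact dvd_sub hd ⟨b * c * p ^ r * p ^ r, by ring⟩

theorem t_cond {g : G p e} {a b c d : ZMod (p ^ e)} {r : ℕ}
    (h : (g : Matrix (Fin 2) (Fin 2) (ZMod (p ^ e))) =
      !![a, b * (p : ZMod (p ^ e)) ^ r; c * (p : ZMod (p ^ e)) ^ r, d]) :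
    IsUnit (a * d - b * c * (p : ZMod (p ^ e)) ^ (2 * r)) := by
  have hu := (Matrix.isUnit_iff_isUnit_det _).mp g.isUnit
  rw [h, Matrix.det_fin_two_of] at hu
  convert hu using 1
  ring

end helpers

variable (p e : ℕ) [Fact p.Prime] [NeZero e]

/-- The split Cartan subgroup of invertible diagonal matrices. -/
def Cs : Subgroup (G p e) where
  carrier := {g | ∃ a d : (ZMod (p ^ e))ˣ,
    (g : Matrix (Fin 2) (Fin 2) (ZMod (p ^ e))) = !![(a : ZMod (p ^ e)), 0; 0, (d : ZMod (p ^ e))]}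
  mul_mem' := by
    rintro g h ⟨a, d, hg⟩ ⟨a', d', hh⟩
    exact ⟨a * a', d * d', by simp [hg, hh]⟩
  one_mem' := ⟨1, 1, by simp [Matrix.one_fin_two]⟩
  inv_mem' := by
    rintro g ⟨a, d, hg⟩
    refine ⟨a⁻¹, d⁻¹, ?_⟩
    rw [Matrix.coe_units_inv]
    apply Matrix.inv_eq_left_inv
    rw [hg]
    simp [Matrix.one_fin_two]

/-- The non-split Cartan subgroup. The parameter `ξ` (to be a non-square unit) is used
only for odd `p`; here `x ≢ 0 mod p` is written as `¬ p ∣ x` in `ℤ/pᵉℤ`. -/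
def Cns (ξ : (ZMod (p ^ e))ˣ) : Subgroup (G p e) where
  carrier := {g | ∃ a b : ZMod (p ^ e),
    ¬ ((p : ZMod (p ^ e)) ∣ a ∧ (p : ZMod (p ^ e)) ∣ b) ∧
    (g : Matrix (Fin 2) (Fin 2) (ZMod (p ^ e))) =
      if p = 2 then !![a, b; b, a + b] else !![a, b * (ξ : ZMod (p ^ e)); b, a]}
  mul_mem' := by
    rintro g h ⟨a, b, -, hg⟩ ⟨a', b', -, hh⟩
    suffices H : ∃ x y : ZMod (p ^ e), ((g * h : G p e) : Matrix _ _ (ZMod (p ^ e))) =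
        if p = 2 then !![x, y; y, x + y] else !![x, y * (ξ : ZMod (p ^ e)); y, x] by
      obtain ⟨x, y, H⟩ := H
      exact ⟨x, y, cns_cond H, H⟩
    rw [Units.val_mul, hg, hh]
    split_ifs
    · refine ⟨a * a' + b * b', a * b' + b * (a' + b'), ?_⟩
      rw [Matrix.mul_fin_two]
      congr! 3 <;> ring_nf
    · refine ⟨a * a' + b * b' * ξ, a * b' + b * a', ?_⟩
      rw [Matrix.mul_fin_two]
      congr! 3 <;> ring_nf
  one_mem' := by
    have H : ((1 : G p e) : Matrix (Fin 2) (Fin 2) (ZMod (p ^ e))) =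
        if p = 2 then !![1, 0; 0, 1 + 0] else !![1, 0 * (ξ : ZMod (p ^ e)); 0, 1] := by
      simp [Matrix.one_fin_two]
    exact ⟨1, 0, cns_cond H, H⟩
  inv_mem' := by
    rintro g ⟨a, b, -, hg⟩
    suffices H : ∃ x y : ZMod (p ^ e), ((g⁻¹ : G p e) : Matrix _ _ (ZMod (p ^ e))) =
        if p = 2 then !![x, y; y, x + y] else !![x, y * (ξ : ZMod (p ^ e)); y, x] by
      obtain ⟨x, y, H⟩ := H
      exact ⟨x, y, cns_cond H, H⟩
    split_ifs at hg ⊢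
    · obtain ⟨t, ht⟩ := coe_inv_of_eq hg
      refine ⟨t * (a + b), t * (-b), ?_⟩
      rw [ht]
      congr! 3
      ring_nf
    · obtain ⟨t, ht⟩ := coe_inv_of_eq hg
      refine ⟨t * a, t * (-b), ?_⟩
      rw [ht]
      congr! 3
      ring_nf

/-- The subgroup of matrices `(a, b pʳ; c pʳ⁺¹, d)` with `ad ≢ 0 mod p`. -/
def B (r : ℕ) : Subgroup (G p e) where
  carrier := {g | ∃ a b c d : ZMod (p ^ e), ¬ (p : ZMod (p ^ e)) ∣ a * d ∧
    (g : Matrix (Fin 2) (Fin 2) (ZMod (p ^ e))) =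
      !![a, b * (p : ZMod (p ^ e)) ^ r; c * (p : ZMod (p ^ e)) ^ (r + 1), d]}
  mul_mem' := by
    rintro g h ⟨a, b, c, d, -, hg⟩ ⟨a', b', c', d', -, hh⟩
    have H : ((g * h : G p e) : Matrix (Fin 2) (Fin 2) (ZMod (p ^ e))) =
        !![a * a' + b * c' * (p : ZMod (p ^ e)) ^ (2 * r + 1),
          (a * b' + b * d') * (p : ZMod (p ^ e)) ^ r;
          (c * a' + d * c') * (p : ZMod (p ^ e)) ^ (r + 1),
          c * b' * (p : ZMod (p ^ e)) ^ (2 * r + 1) + d * d'] := by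
      rw [Units.val_mul, hg, hh, Matrix.mul_fin_two]
      congr! 3 <;> ring_nf
    exact ⟨_, _, _, _, b_cond H, H⟩
  one_mem' := by
    have H : ((1 : G p e) : Matrix (Fin 2) (Fin 2) (ZMod (p ^ e))) =
        !![1, 0 * (p : ZMod (p ^ e)) ^ r; 0 * (p : ZMod (p ^ e)) ^ (r + 1), 1] := by
      simp [Matrix.one_fin_two]
    exact ⟨_, _, _, _, b_cond H, H⟩
  inv_mem' := by
    rintro g ⟨a, b, c, d, -, hg⟩
    obtain ⟨t, ht⟩ := coe_inv_of_eq hg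
    have H : ((g⁻¹ : G p e) : Matrix (Fin 2) (Fin 2) (ZMod (p ^ e))) =
        !![t * d, -(t * b) * (p : ZMod (p ^ e)) ^ r;
          -(t * c) * (p : ZMod (p ^ e)) ^ (r + 1), t * a] := by
      rw [ht]
      congr! 3 <;> ring_nf
    exact ⟨_, _, _, _, b_cond H, H⟩

/-- The subgroup of matrices `(a, b pʳ; c pʳ, d)` with `ad - bc p²ʳ` invertible. -/
def T (r : ℕ) : Subgroup (G p e) where
  carrier := {g | ∃ a b c d : ZMod (p ^ e),
    IsUnit (a * d - b * c * (p : ZMod (p ^ e)) ^ (2 * r)) ∧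
    (g : Matrix (Fin 2) (Fin 2) (ZMod (p ^ e))) =
      !![a, b * (p : ZMod (p ^ e)) ^ r; c * (p : ZMod (p ^ e)) ^ r, d]}
  mul_mem' := by
    rintro g h ⟨a, b, c, d, -, hg⟩ ⟨a', b', c', d', -, hh⟩
    have H : ((g * h : G p e) : Matrix (Fin 2) (Fin 2) (ZMod (p ^ e))) =
        !![a * a' + b * c' * (p : ZMod (p ^ e)) ^ (2 * r),
          (a * b' + b * d') * (p : ZMod (p ^ e)) ^ r;
          (c * a' + d * c') * (p : ZMod (p ^ e)) ^ r,
          c * b' * (p : ZMod (p ^ e)) ^ (2 * r) + d * d'] := by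
      rw [Units.val_mul, hg, hh, Matrix.mul_fin_two]
      congr! 3 <;> ring_nf
    exact ⟨_, _, _, _, t_cond H, H⟩
  one_mem' := by
    have H : ((1 : G p e) : Matrix (Fin 2) (Fin 2) (ZMod (p ^ e))) =
        !![1, 0 * (p : ZMod (p ^ e)) ^ r; 0 * (p : ZMod (p ^ e)) ^ r, 1] := by
      simp [Matrix.one_fin_two]
    exact ⟨_, _, _, _, t_cond H, H⟩
  inv_mem' := by
    rintro g ⟨a, b, c, d, -, hg⟩
    obtain ⟨t, ht⟩ := coe_inv_of_eq hg
    have H : ((g⁻¹ : G p e) : Matrix (Fin 2) (Fin 2) (ZMod (p ^ e))) =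
        !![t * d, -(t * b) * (p : ZMod (p ^ e)) ^ r;
          -(t * c) * (p : ZMod (p ^ e)) ^ r, t * a] := by
      rw [ht]
      congr! 3 <;> ring_nf
    exact ⟨_, _, _, _, t_cond H, H⟩

variable {p e}

/-- The permutation representation `ℚ[G/H]` for the left multiplication action on cosets. -/
noncomputable abbrev perm (H : Subgroup (G p e)) : Representation ℚ (G p e) (ℚ[G p e ⧸ H]) :=
  Representation.ofMulAction ℚ (G p e) (G p e ⧸ H)

/-- The representation `2ℚ[G/H] = ℚ[G/H] ⊕ ℚ[G/H]`. -/
noncomputable abbrev perm2 (H : Subgroup (G p e)) :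
    Representation ℚ (G p e) (ℚ[G p e ⧸ H] × ℚ[G p e ⧸ H]) :=
  (perm H).prod (perm H)

end CartanChen

/-!
Over a field of characteristic zero a finite-dimensional representation of a finite group is
determined by its character (`Representation.nonempty_equiv_of_character_eq`), and the character of
a permutation representation counts fixed points. The isomorphism thus amounts to an identity
between fixed point numbers, for each `g` in `GL₂(ℤ/pᵉℤ)`: `CartanChen.fixedPoint_identity`.

A coset `x H` is fixed by `g` iff `x⁻¹ g x ∈ H`. For `H = T r` and `H = B r` this depends only on
the binary quadratic form `Q u = det (u, g u)` of `g`: with `u`, `v` the columns of `x`, it says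
that `pʳ` divides `Q u` and `Q v`, respectively that `pʳ⁺¹` divides `Q u` and `pʳ` divides `Q v`. The
split Cartan subgroup is `T e`. For `H = Cns` it says that `Q ∘ x` is a multiple of the norm form of
the unramified quadratic extension, which has no zero modulo `p`.

Let `k ≤ e` be maximal such that `g` is scalar modulo `pᵏ`, so that `Q = pᵏ Q'`. Every
coset of `T r` with `r ≤ k` and of `B r` with `r < k` is fixed, so these contribute their indices,
and if `k = e` the same holds for `Cns`. If `k < e`, the form `Q'` is nonzero modulo `p`, and up to
conjugation there are three cases
(`CartanChen.exists_conj_isMulForm`).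

* `Q'` is anisotropic modulo `p`. No coset of `T r` with `r > k` or of `B r` with `r ≥ k` is fixed,
  and `Cns` contributes `2 p²ᵏ` (`CartanChen.card_fixedBy_Cns_of_anisotropic`).
* `Q'` has two distinct roots modulo `p`. Each `T r` with `r > k` and each `B r` with `r ≥ k`
  contributes `2 p²ᵏ`, and `Cns` contributes nothing.
* `Q'` has a double root modulo `p`. Only `B k` contributes beyond the indices, namely `p²ᵏ`.

In all cases the identity follows from a telescoping sum of indices
(`CartanChen.sum_indexB_add_pow`).
-/

/-! ### Characters determine representations in characteristic zero -/

namespace Representation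

section Character

variable {G k V W : Type*} [Group G] [Field k] [AddCommGroup V] [Module k V]
  [AddCommGroup W] [Module k W]

theorem char_prod [FiniteDimensional k V] [FiniteDimensional k W]
    (ρ : Representation k G V) (σ : Representation k G W) (g : G) :
    (ρ.prod σ).character g = ρ.character g + σ.character g :=
  LinearMap.trace_prodMap' (ρ g) (σ g)

theorem char_directSum {ι : Type*} [Fintype ι] {V : ι → Type*} [∀ i, AddCommGroup (V i)]
    [∀ i, Module k (V i)] [∀ i, FiniteDimensional k (V i)]
    (ρ : ∀ i, Representation k G (V i)) (g : G) :
    (directSum ρ).character g = ∑ i, (ρ i).character g := by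
  classical
  have h : directSum ρ g =
      ∑ i, DirectSum.lof k ι V i ∘ₗ (ρ i g ∘ₗ DirectSum.component k ι V i) := by
    refine DirectSum.linearMap_ext _ fun j => LinearMap.ext fun v => ?_
    simp only [directSum_apply, LinearMap.comp_apply, LinearMap.sum_apply]
    rw [Finset.sum_eq_single j]
    · simp [DirectSum.component.lof_self, DirectSum.lmap_lof]
    · intro i _ hij
      rw [DirectSum.component.of, dif_neg (Ne.symm hij)]
      simp
    · simp
  rw [character, h, map_sum]
  refine Finset.sum_congr rfl fun i _ => ?_
  have hi : DirectSum.component k ι V i ∘ₗ DirectSum.lof k ι V i = LinearMap.id :=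
    LinearMap.ext fun v => DirectSum.component.lof_self k i v
  rw [LinearMap.trace_comp_comm', LinearMap.comp_assoc, hi, LinearMap.comp_id, character]

theorem char_ofMulAction {X : Type*} [Finite X] [MulAction G X] (g : G) :
    (ofMulAction k G X).character g = Nat.card (MulAction.fixedBy X g) := by
  classical
  have := Fintype.ofFinite X
  let b : Module.Basis X k k[X] := ⟨MonoidAlgebra.coeffLinearEquiv k⟩
  have hb : ∀ x, b x = MonoidAlgebra.single x 1 := fun x => rfl
  rw [character, LinearMap.trace_eq_matrix_trace k b, Matrix.trace]
  have : ∀ x, (LinearMap.toMatrix b b (ofMulAction k G X g)).diag x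
      = if g • x = x then 1 else 0 := by
    intro x
    rw [Matrix.diag_apply, LinearMap.toMatrix_apply, hb, ofMulAction_single, ← hb,
      Module.Basis.repr_self, Finsupp.single_apply]
  simp only [this]
  rw [Finset.sum_boole, Nat.card_eq_fintype_card, Fintype.card_subtype]
  rfl

end Character

variable {G k V W U : Type*} [Group G] [Finite G] [Field k] [CharZero k]
  [AddCommGroup V] [Module k V] [AddCommGroup W] [Module k W] [AddCommGroup U] [Module k U]

/-- Maschke's theorem in split form: a representation that embeds is a direct factor. -/
theorem exists_prod_equiv_of_injective {τ : Representation k G U} {σ : Representation k G W}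
    (f : IntertwiningMap τ σ) (hf : Function.Injective f) :
    ∃ (W' : Submodule k W) (σ' : Representation k G W'), Nonempty ((τ.prod σ').Equiv σ) := by
  have : NeZero (Nat.card G : k) := ⟨Nat.cast_ne_zero.mpr Nat.card_pos.ne'⟩
  obtain ⟨r', hr'⟩ := MonoidAlgebra.exists_leftInverse_of_injective
    (IntertwiningMap.equivLinearMapAsModule τ σ f) (LinearMap.ker_eq_bot.mpr hf)
  let r := (IntertwiningMap.equivLinearMapAsModule σ τ).symm r'
  have hr : ∀ u, r (f u) = u := fun u => LinearMap.congr_fun hr' u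
  let σ' := σ.subrepresentation (LinearMap.ker r.toLinearMap) fun g w hw => by
    have h : r (σ g w) = τ g (r w) := r.isIntertwining _ _ g w
    have hw' : r w = 0 := hw
    change r (σ g w) = 0
    rw [h, hw', map_zero]
  refine ⟨_, σ', ⟨IntertwiningMap.ofBijective
    ⟨f.toLinearMap.coprod (Submodule.subtype _), fun g => ?_⟩ ⟨?_, ?_⟩⟩⟩
  · refine LinearMap.ext fun x => ?_
    have h := f.isIntertwining _ _ g x.1
    change f (τ g x.1) + σ g x.2 = σ g (f x.1 + x.2)
    rw [map_add, h]
  · rintro ⟨u, w⟩ ⟨u', w'⟩ h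
    have h : f u + (w : W) = f u' + w' := h
    have hw : r (w : W) = 0 := w.2
    have hw' : r (w' : W) = 0 := w'.2
    have h1 := congrArg r h
    rw [map_add, map_add, hr, hr, hw, hw', add_zero, add_zero] at h1
    subst h1
    exact Prod.ext rfl (Subtype.ext (add_left_cancel h))
  · intro w
    refine ⟨(r w, ⟨w - f (r w), ?_⟩), ?_⟩
    · change r (w - f (r w)) = 0
      rw [map_sub, hr, sub_self]
    · change f (r w) + (w - f (r w)) = w
      abel

/-- Over a field of characteristic zero, not necessarily algebraically closed, characters
determine the dimensions of all spaces of intertwining maps, and hence an irreducible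
constituent of one representation also occurs in the other; it can then be split off. -/
theorem nonempty_equiv_of_character_eq [FiniteDimensional k V] [FiniteDimensional k W]
    (ρ : Representation k G V) (σ : Representation k G W) (h : ρ.character = σ.character) :
    Nonempty (ρ.Equiv σ) := by
  have : NeZero (Nat.card G : k) := ⟨Nat.cast_ne_zero.mpr Nat.card_pos.ne'⟩
  have : Invertible (Nat.card G : k) := invertibleOfNonzero (NeZero.ne _)
  have := Fintype.ofFinite G
  obtain ⟨n, hn⟩ : ∃ n, Module.finrank k V = n := ⟨_, rfl⟩
  induction n using Nat.strong_induction_on generalizing V W with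
  | _ n ih =>
  have hfr : Module.finrank k V = Module.finrank k W := by
    have h1 := congrFun h 1
    rw [char_one, char_one] at h1
    exact_mod_cast h1
  rcases subsingleton_or_nontrivial V with hV | hV
  · have : Subsingleton W := by
      rw [← Module.finrank_zero_iff (R := k), ← hfr, Module.finrank_zero_of_subsingleton]
    exact ⟨Equiv.mk (LinearEquiv.ofFinrankEq V W hfr) fun g =>
      LinearMap.ext fun v => Subsingleton.elim _ _⟩
  · obtain ⟨S, ⟨hS0, hS⟩, hmin⟩ := wellFounded_lt.has_min
      {U : Submodule k V | U ≠ ⊥ ∧ ∀ g, U ≤ U.comap (ρ g)} ⟨⊤, top_ne_bot, fun g => le_top⟩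
    let τ := ρ.subrepresentation S hS
    have hSpos : 0 < Module.finrank k S := by
      rw [Nat.pos_iff_ne_zero, Ne, Submodule.finrank_eq_zero]
      exact hS0
    let i : IntertwiningMap τ ρ := ⟨S.subtype, fun g => rfl⟩
    have hi : Function.Injective i := S.injective_subtype
    have hfin : Module.finrank k (IntertwiningMap τ ρ) =
        Module.finrank k (IntertwiningMap τ σ) := by
      have h1 := card_inv_mul_sum_char_mul_char_eq_finrank τ ρ
      rw [h, card_inv_mul_sum_char_mul_char_eq_finrank τ σ] at h1
      exact_mod_cast h1.symm
    obtain ⟨f, hf0⟩ : ∃ f : IntertwiningMap τ σ, f ≠ 0 := by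
      have : Nontrivial (IntertwiningMap τ ρ) := by
        refine ⟨i, 0, fun h0 => hS0 ?_⟩
        rw [Submodule.eq_bot_iff]
        intro v hv
        exact congrArg (fun j : IntertwiningMap τ ρ => j ⟨v, hv⟩) h0
      have := Module.finrank_pos (R := k) (M := IntertwiningMap τ ρ)
      rw [hfin] at this
      have := Module.nontrivial_of_finrank_pos this
      exact exists_ne 0
    -- The kernel of `f` is an invariant subspace of `S`, so it vanishes by minimality of `S`.
    have hf : Function.Injective f := by
      by_contra hinj
      refine hmin ((LinearMap.ker f.toLinearMap).map S.subtype) ⟨fun hbot => hinj ?_, ?_⟩ ?_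
      · exact LinearMap.ker_eq_bot.mp (Submodule.map_injective_of_injective S.injective_subtype
          (hbot.trans (Submodule.map_bot _).symm))
      · rintro g _ ⟨s, hs, rfl⟩
        refine ⟨τ g s, ?_, rfl⟩
        have hs : f s = 0 := hs
        change f (τ g s) = 0
        rw [f.isIntertwining, hs, map_zero]
      · refine lt_of_le_of_ne (Submodule.map_subtype_le _ _) fun heq => hf0 ?_
        ext s
        obtain ⟨s', hs', hss⟩ := heq.ge s.2
        obtain rfl : s' = s := Subtype.ext hss
        exact hs'
    obtain ⟨V', ρ', ⟨eV⟩⟩ := exists_prod_equiv_of_injective i hi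
    obtain ⟨W', σ', ⟨eW⟩⟩ := exists_prod_equiv_of_injective f hf
    have hchar : ρ'.character = σ'.character := by
      funext g
      have h1 := congrFun h g
      rw [← char_iso eV, ← char_iso eW, char_prod, char_prod] at h1
      exact add_left_cancel h1
    have hdim : Module.finrank k V' < n := by
      rw [← hn, ← eV.toLinearEquiv.finrank_eq, Module.finrank_prod]
      omega
    obtain ⟨e⟩ := ih _ hdim ρ' σ' hchar rfl
    let e' : (τ.prod ρ').Equiv (τ.prod σ') :=
      Equiv.mk (LinearEquiv.prodCongr (LinearEquiv.refl k S) e.toLinearEquiv) fun g => by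
        refine LinearMap.ext fun x => Prod.ext rfl ?_
        exact e.toIntertwiningMap.isIntertwining _ _ g x.2
    exact ⟨(eV.symm.trans e').trans eW⟩

end Representation

/-! ### Fixed points on cosets, and congruences in `ℤ/pᵉℤ` -/

/-- Fixed points on `Γ ⧸ H` counted by elements: `g` fixes `x H` iff `x⁻¹ g x ∈ H`. -/
theorem Subgroup.card_mul_card_fixedBy_quotient {Γ : Type*} [Group Γ] (H : Subgroup Γ) (g : Γ) :
    Nat.card H * Nat.card (MulAction.fixedBy (Γ ⧸ H) g) =
      Nat.card {x : Γ // x⁻¹ * g * x ∈ H} := by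
  rw [← Nat.card_prod, ← Nat.card_congr (QuotientGroup.preimageMkEquivSubgroupProdSet H _)]
  refine Nat.card_congr (Equiv.subtypeEquivRight fun x => ?_)
  rw [Set.mem_preimage, MulAction.mem_fixedBy, MulAction.Quotient.smul_coe, eq_comm,
    QuotientGroup.eq, smul_eq_mul, mul_assoc]

theorem Subgroup.card_fixedBy_quotient_conj {Γ : Type*} [Group Γ] [Finite Γ] (H : Subgroup Γ)
    (g h : Γ) :
    Nat.card (MulAction.fixedBy (Γ ⧸ H) (h⁻¹ * g * h)) =
      Nat.card (MulAction.fixedBy (Γ ⧸ H) g) := by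
  refine Nat.eq_of_mul_eq_mul_left (Nat.card_pos (α := H)) ?_
  rw [H.card_mul_card_fixedBy_quotient, H.card_mul_card_fixedBy_quotient]
  refine Nat.card_congr ((Equiv.mulLeft h).subtypeEquiv fun x => ?_)
  simp only [Equiv.coe_mulLeft, mul_inv_rev, mul_assoc]

/-- A set of elements meeting every left coset of `H` exactly once computes fixed points. -/
theorem Subgroup.card_fixedBy_quotient_of_transversal {Γ : Type*} [Group Γ] (H : Subgroup Γ)
    (K : Set Γ) (hinj : ∀ x ∈ K, ∀ y ∈ K, x⁻¹ * y ∈ H → x = y)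
    (hsurj : ∀ x, ∃ h ∈ H, x * h ∈ K) (g : Γ) :
    Nat.card (MulAction.fixedBy (Γ ⧸ H) g) = Nat.card {x : Γ // x ∈ K ∧ x⁻¹ * g * x ∈ H} := by
  have key : ∀ x : Γ, (x : Γ ⧸ H) ∈ MulAction.fixedBy (Γ ⧸ H) g ↔ x⁻¹ * g * x ∈ H := by
    intro x
    rw [MulAction.mem_fixedBy, MulAction.Quotient.smul_coe, eq_comm,
      QuotientGroup.eq, smul_eq_mul, mul_assoc]
  refine (Nat.card_congr (Equiv.ofBijective
    (fun x : {x : Γ // x ∈ K ∧ x⁻¹ * g * x ∈ H} =>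
      (⟨(x.1 : Γ ⧸ H), (key x.1).2 x.2.2⟩ : MulAction.fixedBy (Γ ⧸ H) g)) ⟨?_, ?_⟩)).symm
  · rintro ⟨x, hx, _⟩ ⟨y, hy, _⟩ hxy
    exact Subtype.ext (hinj x hx y hy (QuotientGroup.eq.mp (congrArg Subtype.val hxy)))
  · rintro ⟨c, hc⟩
    obtain ⟨x, rfl⟩ := QuotientGroup.mk_surjective c
    obtain ⟨h, hh, hK⟩ := hsurj x
    have hxh : ((x * h : Γ) : Γ ⧸ H) = x := QuotientGroup.mk_mul_of_mem x hh
    exact ⟨⟨x * h, hK, (key _).1 (hxh.symm ▸ hc)⟩, Subtype.ext hxh⟩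

namespace CartanChen

section Ring

variable {p e : ℕ}

theorem prime_pow_eq_zero (p e : ℕ) : (p : ZMod (p ^ e)) ^ e = 0 := by
  rw [← Nat.cast_pow, ZMod.natCast_self]

theorem pow_dvd_natCast_iff {j : ℕ} (hj : j ≤ e) (n : ℕ) :
    (p : ZMod (p ^ e)) ^ j ∣ (n : ZMod (p ^ e)) ↔ p ^ j ∣ n := by
  constructor
  · intro h
    have h1 := map_dvd (ZMod.castHom (pow_dvd_pow p hj) (ZMod (p ^ j))) h
    rwa [map_pow, map_natCast, map_natCast, prime_pow_eq_zero, zero_dvd_iff,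
      ZMod.natCast_eq_zero_iff] at h1
  · rintro ⟨m, rfl⟩
    exact ⟨m, by push_cast; ring⟩

variable [Fact p.Prime]

theorem pow_dvd_pow_mul_iff {j k : ℕ} (hkj : k ≤ j) (hj : j ≤ e) (y : ZMod (p ^ e)) :
    (p : ZMod (p ^ e)) ^ j ∣ (p : ZMod (p ^ e)) ^ k * y ↔ (p : ZMod (p ^ e)) ^ (j - k) ∣ y := by
  obtain ⟨n, rfl⟩ := ZMod.natCast_zmod_surjective y
  have hp : p.Prime := Fact.out
  rw [← Nat.cast_pow p k, ← Nat.cast_mul, pow_dvd_natCast_iff hj,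
    pow_dvd_natCast_iff ((Nat.sub_le _ _).trans hj)]
  conv_lhs => rw [← Nat.add_sub_cancel' hkj, pow_add]
  exact Nat.mul_dvd_mul_iff_left (pow_pos hp.pos k)

theorem card_pow_dvd {j : ℕ} (hj : j ≤ e) :
    Nat.card {y : ZMod (p ^ e) // (p : ZMod (p ^ e)) ^ j ∣ y} = p ^ (e - j) := by
  have hp : p.Prime := Fact.out
  let f := (ZMod.castHom (pow_dvd_pow p hj) (ZMod (p ^ j))).toAddMonoidHom
  have hf : ∀ y, (p : ZMod (p ^ e)) ^ j ∣ y ↔ y ∈ f.ker := by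
    intro y
    obtain ⟨n, rfl⟩ := ZMod.natCast_zmod_surjective y
    rw [pow_dvd_natCast_iff hj, AddMonoidHom.mem_ker]
    change _ ↔ ZMod.castHom (pow_dvd_pow p hj) (ZMod (p ^ j)) _ = 0
    rw [map_natCast, ZMod.natCast_eq_zero_iff]
  rw [Nat.card_congr (Equiv.subtypeEquivRight hf)]
  have h1 := f.ker.card_mul_index
  rw [AddSubgroup.index_ker,
    AddMonoidHom.range_eq_top.mpr (ZMod.castHom_surjective (pow_dvd_pow p hj)),
    AddSubgroup.card_top, Nat.card_zmod, Nat.card_zmod] at h1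
  refine Nat.eq_of_mul_eq_mul_right (pow_pos hp.pos j) (h1.trans ?_)
  rw [← pow_add, Nat.sub_add_cancel hj]

theorem card_pow_dvd_of_injective {F : ZMod (p ^ e) → ZMod (p ^ e)} (hF : Function.Injective F)
    {j : ℕ} (hj : j ≤ e) :
    Nat.card {y : ZMod (p ^ e) // (p : ZMod (p ^ e)) ^ j ∣ F y} = p ^ (e - j) := by
  rw [← card_pow_dvd (p := p) hj]
  exact Nat.card_congr ((Equiv.ofBijective F (Finite.injective_iff_bijective.mp hF)).subtypeEquiv
    fun y => Iff.rfl)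

variable [NeZero e]

theorem isUnit_iff_not_dvd (y : ZMod (p ^ e)) : IsUnit y ↔ ¬ (p : ZMod (p ^ e)) ∣ y := by
  obtain ⟨n, rfl⟩ := ZMod.natCast_zmod_surjective y
  have hp : p.Prime := Fact.out
  have h := pow_dvd_natCast_iff (p := p) (e := e) (Nat.one_le_iff_ne_zero.mpr (NeZero.ne e)) n
  rw [pow_one, pow_one] at h
  rw [ZMod.isUnit_iff_coprime, h, Nat.coprime_comm,
    Nat.coprime_pow_left_iff (Nat.pos_of_ne_zero (NeZero.ne e)), hp.coprime_iff_not_dvd]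

theorem prime_cast_dvd_mul {x y : ZMod (p ^ e)} :
    (p : ZMod (p ^ e)) ∣ x * y ↔ (p : ZMod (p ^ e)) ∣ x ∨ (p : ZMod (p ^ e)) ∣ y := by
  have h := IsUnit.mul_iff (x := x) (y := y)
  rw [isUnit_iff_not_dvd, isUnit_iff_not_dvd, isUnit_iff_not_dvd] at h
  tauto

/-- A quadratic congruence whose two roots are distinct modulo `p`. -/
theorem card_pow_dvd_mul_of_isUnit_sub {r₁ r₂ : ZMod (p ^ e)} (h : IsUnit (r₁ - r₂)) {j : ℕ}
    (hj : j ≤ e) (hj0 : j ≠ 0) :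
    Nat.card {s : ZMod (p ^ e) // (p : ZMod (p ^ e)) ^ j ∣ (s - r₁) * (s - r₂)} =
      2 * p ^ (e - j) := by
  have hpj : (p : ZMod (p ^ e)) ∣ (p : ZMod (p ^ e)) ^ j := dvd_pow_self _ hj0
  have hor : ∀ s : ZMod (p ^ e), (p : ZMod (p ^ e)) ^ j ∣ (s - r₁) * (s - r₂) ↔
      ((p : ZMod (p ^ e)) ^ j ∣ s - r₁ ∨ (p : ZMod (p ^ e)) ^ j ∣ s - r₂) := by
    intro s
    refine ⟨fun hs => ?_, fun hs => hs.elim (Dvd.dvd.mul_right · _) (Dvd.dvd.mul_left · _)⟩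
    by_cases h1 : IsUnit (s - r₁)
    · exact Or.inr ((h1.dvd_mul_left).mp hs)
    · refine Or.inl ((IsUnit.dvd_mul_right ?_).mp hs)
      rw [isUnit_iff_not_dvd] at h h1 ⊢
      rw [not_not] at h1
      intro h2
      exact h (by simpa using dvd_sub h2 h1)
  have hdisj : Disjoint (fun s : ZMod (p ^ e) => (p : ZMod (p ^ e)) ^ j ∣ s - r₁)
      (fun s : ZMod (p ^ e) => (p : ZMod (p ^ e)) ^ j ∣ s - r₂) := by
    rw [Pi.disjoint_iff]
    intro s
    rw [Prop.disjoint_iff, not_and]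
    intro h1 h2
    rw [isUnit_iff_not_dvd] at h
    exact h (by simpa using dvd_sub (hpj.trans h2) (hpj.trans h1))
  classical
  rw [Nat.card_congr (Equiv.subtypeEquivRight hor), Nat.card_eq_fintype_card,
    Fintype.card_subtype_or_disjoint _ _ hdisj, ← Nat.card_eq_fintype_card,
    ← Nat.card_eq_fintype_card, card_pow_dvd_of_injective (sub_left_injective) hj,
    card_pow_dvd_of_injective (sub_left_injective) hj, two_mul]

theorem card_units : Nat.card (ZMod (p ^ e))ˣ = p ^ (e - 1) * (p - 1) := by
  rw [Nat.card_eq_fintype_card, ZMod.card_units_eq_totient,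
    Nat.totient_prime_pow Fact.out (Nat.pos_of_ne_zero (NeZero.ne e))]

end Ring

end CartanChen

/-! ### The quadratic form of a matrix and membership in the subgroups -/

namespace CartanChen

/-- The binary quadratic form `A s² + B s t + C t²`. -/
def binForm {R : Type*} [CommRing R] (A B C s t : R) : R := A * s ^ 2 + B * (s * t) + C * t ^ 2

/-- The polar form of `binForm A B C`, evaluated at `(s, t)` and `(s', t')`. -/
def binPolar {R : Type*} [CommRing R] (A B C s t s' t' : R) : R :=
  2 * A * (s * s') + B * (s * t' + s' * t) + 2 * C * (t * t')

section

variable {p e : ℕ}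

/-- The quadratic form `u ↦ det (u, g u)` equals `pᵏ` times the form `A s² + B s t + C t²`. In
particular `g` is scalar modulo `pᵏ`; the form `(A, B, C)`, determined modulo `pᵉ⁻ᵏ` only, is the
residual form of `g` at level `k`. -/
def IsMulForm (g : G p e) (k : ℕ) (A B C : ZMod (p ^ e)) : Prop :=
  g.val 1 0 = (p : ZMod (p ^ e)) ^ k * A ∧
  g.val 1 1 - g.val 0 0 = (p : ZMod (p ^ e)) ^ k * B ∧
  -g.val 0 1 = (p : ZMod (p ^ e)) ^ k * C

/-- Base change acts on the form `u ↦ det (u, g u)` by substitution, up to a unit. -/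
theorem IsMulForm.conj {g : G p e} {k : ℕ} {A B C : ZMod (p ^ e)} (h : IsMulForm g k A B C)
    (x : G p e) : ∃ w : (ZMod (p ^ e))ˣ, IsMulForm (x⁻¹ * g * x) k
      (w * binForm A B C (x.val 0 0) (x.val 1 0))
      (w * binPolar A B C (x.val 0 0) (x.val 1 0) (x.val 0 1) (x.val 1 1))
      (w * binForm A B C (x.val 0 1) (x.val 1 1)) := by
  have hdet : IsUnit x.val.det := (Matrix.isUnit_iff_isUnit_det _).mp x.isUnit
  obtain ⟨w, hw⟩ := hdet
  have hinv : (x⁻¹).val = (w⁻¹).val • !![x.val 1 1, -x.val 0 1; -x.val 1 0, x.val 0 0] := by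
    rw [Matrix.coe_units_inv, Matrix.inv_def, ← hw, Ring.inverse_unit, Matrix.adjugate_fin_two]
  obtain ⟨h1, h2, h3⟩ := h
  refine ⟨w⁻¹, ?_, ?_, ?_⟩ <;>
  · simp only [Units.val_mul, hinv, Matrix.mul_apply, Fin.sum_univ_two, Matrix.smul_apply,
      smul_eq_mul, Matrix.of_apply, Matrix.cons_val', Matrix.cons_val_zero, Matrix.cons_val_one,
      Matrix.cons_val_fin_one, binForm, binPolar]
    first
    | linear_combination (w⁻¹).val * (x.val 0 0 ^ 2 * h1 + x.val 0 0 * x.val 1 0 * h2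
        + x.val 1 0 ^ 2 * h3)
    | linear_combination (w⁻¹).val * (x.val 0 1 ^ 2 * h1 + x.val 0 1 * x.val 1 1 * h2
        + x.val 1 1 ^ 2 * h3)
    | linear_combination (w⁻¹).val * (2 * x.val 0 0 * x.val 0 1 * h1
        + (x.val 0 0 * x.val 1 1 + x.val 0 1 * x.val 1 0) * h2 + 2 * x.val 1 0 * x.val 1 1 * h3)

theorem isMulForm_zero (g : G p e) :
    IsMulForm g 0 (g.val 1 0) (g.val 1 1 - g.val 0 0) (-g.val 0 1) := by
  simp [IsMulForm]

theorem exists_isMulForm_conj_iff (g x : G p e) (k : ℕ) :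
    (∃ A B C, IsMulForm (x⁻¹ * g * x) k A B C) ↔ ∃ A B C, IsMulForm g k A B C := by
  constructor
  · rintro ⟨A, B, C, h⟩
    obtain ⟨w, hw⟩ := h.conj x⁻¹
    have : x⁻¹⁻¹ * (x⁻¹ * g * x) * x⁻¹ = g := by group
    rw [this] at hw
    exact ⟨_, _, _, hw⟩
  · rintro ⟨A, B, C, h⟩
    obtain ⟨w, hw⟩ := h.conj x
    exact ⟨_, _, _, hw⟩

variable [Fact p.Prime]

theorem isUnit_two (hp : p ≠ 2) : IsUnit (2 : ZMod (p ^ e)) := by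
  have : ((2 : ℕ) : ZMod (p ^ e)) = 2 := by norm_cast
  rw [← this, ZMod.isUnit_iff_coprime]
  exact Nat.Coprime.pow_right _ ((Nat.coprime_primes Nat.prime_two Fact.out).mpr hp.symm)

variable [NeZero e]

theorem mem_T_iff {r : ℕ} {g : G p e} : g ∈ T p e r ↔
    (p : ZMod (p ^ e)) ^ r ∣ g.val 0 1 ∧ (p : ZMod (p ^ e)) ^ r ∣ g.val 1 0 := by
  constructor
  · rintro ⟨a, b, c, d, -, h⟩
    rw [h]
    exact ⟨Dvd.intro_left _ rfl, Dvd.intro_left _ rfl⟩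
  · rintro ⟨⟨b, hb⟩, ⟨c, hc⟩⟩
    have H : g.val = !![g.val 0 0, b * (p : ZMod (p ^ e)) ^ r;
        c * (p : ZMod (p ^ e)) ^ r, g.val 1 1] := by
      rw [mul_comm b, mul_comm c, ← hb, ← hc]
      exact Matrix.eta_fin_two _
    exact ⟨_, _, _, _, t_cond H, H⟩

theorem mem_B_iff {r : ℕ} {g : G p e} : g ∈ B p e r ↔
    (p : ZMod (p ^ e)) ^ r ∣ g.val 0 1 ∧ (p : ZMod (p ^ e)) ^ (r + 1) ∣ g.val 1 0 := by
  constructor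
  · rintro ⟨a, b, c, d, -, h⟩
    rw [h]
    exact ⟨Dvd.intro_left _ rfl, Dvd.intro_left _ rfl⟩
  · rintro ⟨⟨b, hb⟩, ⟨c, hc⟩⟩
    have H : g.val = !![g.val 0 0, b * (p : ZMod (p ^ e)) ^ r;
        c * (p : ZMod (p ^ e)) ^ (r + 1), g.val 1 1] := by
      rw [mul_comm b, mul_comm c, ← hb, ← hc]
      exact Matrix.eta_fin_two _
    exact ⟨_, _, _, _, b_cond H, H⟩

theorem Cs_eq_T : Cs p e = T p e e := by
  ext g
  rw [mem_T_iff, prime_pow_eq_zero, zero_dvd_iff, zero_dvd_iff]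
  constructor
  · rintro ⟨a, d, h⟩
    rw [h]
    exact ⟨rfl, rfl⟩
  · rintro ⟨hb, hc⟩
    have hu : IsUnit g.val.det := (Matrix.isUnit_iff_isUnit_det _).mp g.isUnit
    rw [Matrix.det_fin_two, hb, zero_mul, sub_zero, IsUnit.mul_iff] at hu
    refine ⟨hu.1.unit, hu.2.unit, ?_⟩
    conv_lhs => rw [Matrix.eta_fin_two g.val, hb, hc]
    rfl

/-- The trace coefficient `τ` of the polynomial `X² - τ X - ν` whose companion algebra has
`Cns` as unit group: `X² - X - 1` for `p = 2` and `X² - ξ` for odd `p`. -/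
def nsTrace (p e : ℕ) : ZMod (p ^ e) := if p = 2 then 1 else 0

/-- The constant coefficient `ν` of the polynomial `X² - τ X - ν` whose companion algebra has
`Cns` as unit group: `X² - X - 1` for `p = 2` and `X² - ξ` for odd `p`. -/
def nsNorm (ξ : (ZMod (p ^ e))ˣ) : ZMod (p ^ e) := if p = 2 then 1 else ξ

theorem mem_Cns_iff {ξ : (ZMod (p ^ e))ˣ} {g : G p e} : g ∈ Cns p e ξ ↔
    g.val 0 1 = nsNorm ξ * g.val 1 0 ∧ g.val 1 1 - g.val 0 0 = nsTrace p e * g.val 1 0 := by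
  constructor
  · rintro ⟨a, b, -, h⟩
    rw [h, nsNorm, nsTrace]
    split_ifs
    · simp
    · simp [mul_comm]
  · rintro ⟨h1, h2⟩
    have H : g.val = if p = 2 then !![g.val 0 0, g.val 1 0; g.val 1 0, g.val 0 0 + g.val 1 0]
        else !![g.val 0 0, g.val 1 0 * (ξ : ZMod (p ^ e)); g.val 1 0, g.val 0 0] := by
      rw [sub_eq_iff_eq_add] at h2
      conv_lhs => rw [Matrix.eta_fin_two g.val, h1, h2, nsNorm, nsTrace]
      split_ifs
      · rw [one_mul, add_comm]
      · rw [zero_mul, zero_add, mul_comm]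
    exact ⟨_, _, cns_cond H, H⟩

/-- A quadratic instance of Hensel's lemma: `z ↦ u z + z²` is injective, hence bijective, on the
maximal ideal. -/
theorem exists_mul_add_sq_eq {u w : ZMod (p ^ e)} (hu : IsUnit u) (hw : (p : ZMod (p ^ e)) ∣ w) :
    ∃ z, (p : ZMod (p ^ e)) ∣ z ∧ u * z + z ^ 2 = w := by
  let I := {z : ZMod (p ^ e) // (p : ZMod (p ^ e)) ∣ z}
  let f : I → I := fun z => ⟨u * z.1 + z.1 ^ 2,
    dvd_add (z.2.mul_left _) (z.2.trans (dvd_pow_self _ two_ne_zero))⟩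
  have hf : Function.Injective f := by
    rintro ⟨z, hz⟩ ⟨z', hz'⟩ h
    have h : u * z + z ^ 2 = u * z' + z' ^ 2 := congrArg Subtype.val h
    have hu' : IsUnit (u + (z + z')) := by
      rw [isUnit_iff_not_dvd] at hu ⊢
      exact fun hd => hu ((dvd_add_left (dvd_add hz hz')).mp hd)
    have h0 : (u + (z + z')) * (z - z') = 0 := by linear_combination h
    exact Subtype.ext (sub_eq_zero.mp (hu'.mul_right_eq_zero.mp h0))
  obtain ⟨z, hz⟩ := (Finite.injective_iff_surjective.mp hf) ⟨w, hw⟩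
  exact ⟨z.1, z.2, congrArg Subtype.val hz⟩

theorem isSquare_of_dvd_sub_sq (hp : p ≠ 2) {y η : ZMod (p ^ e)} (hη : IsUnit η)
    (h : (p : ZMod (p ^ e)) ∣ y - η ^ 2) : IsSquare y := by
  obtain ⟨z, -, hz⟩ := exists_mul_add_sq_eq ((isUnit_two hp).mul hη) h
  exact ⟨η + z, by linear_combination -hz⟩

/-- By Hensel's lemma squareness of units is decided in the residue field, where the product of two
non-squares is a square. -/
theorem isSquare_mul_of_not_isSquare (hp : p ≠ 2) {x y : ZMod (p ^ e)} (hx : IsUnit x)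
    (hy : IsUnit y) (hxs : ¬ IsSquare x) (hys : ¬ IsSquare y) : IsSquare (x * y) := by
  let f := ZMod.castHom (dvd_pow_self p (NeZero.ne e)) (ZMod p)
  have hker : ∀ z, f z = 0 → (p : ZMod (p ^ e)) ∣ z := by
    intro z hz
    obtain ⟨n, rfl⟩ := ZMod.natCast_zmod_surjective z
    rw [map_natCast, ZMod.natCast_eq_zero_iff] at hz
    exact Nat.cast_dvd_cast hz
  have lift : ∀ z, IsUnit z → IsSquare (f z) → IsSquare z := by
    rintro z hz ⟨η, hη⟩
    obtain ⟨η, rfl⟩ := ZMod.castHom_surjective (dvd_pow_self p (NeZero.ne e)) η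
    have hd : (p : ZMod (p ^ e)) ∣ z - η ^ 2 := by
      apply hker
      rw [map_sub, map_pow, hη, sq, sub_self]
    refine isSquare_of_dvd_sub_sq hp ?_ hd
    rw [isUnit_iff_not_dvd] at hz ⊢
    exact fun h => hz ((dvd_sub_left (h.trans (dvd_pow_self _ two_ne_zero))).mp hd)
  have hF : ringChar (ZMod p) ≠ 2 := by rwa [ZMod.ringChar_zmod_n]
  have hχ : ∀ z, IsUnit z → ¬ IsSquare z → quadraticChar (ZMod p) (f z) = -1 := fun z hz hzs =>
    quadraticChar_neg_one_iff_not_isSquare.mpr fun h => hzs (lift z hz h)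
  refine lift _ (hx.mul hy) ((quadraticChar_one_iff_isSquare ((hx.mul hy).map f).ne_zero).mp ?_)
  rw [map_mul, map_mul, hχ x hx hxs, hχ y hy hys]
  norm_num

theorem two_dvd_or_dvd_sub_one {e : ℕ} (x : ZMod (2 ^ e)) :
    ((2 : ℕ) : ZMod (2 ^ e)) ∣ x ∨ ((2 : ℕ) : ZMod (2 ^ e)) ∣ x - 1 := by
  obtain ⟨n, rfl⟩ := ZMod.natCast_zmod_surjective x
  rcases Nat.even_or_odd' n with ⟨m, rfl | rfl⟩
  · exact Or.inl ⟨m, by push_cast; ring⟩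
  · exact Or.inr ⟨m, by push_cast; ring⟩

/-- The norm form of the unramified quadratic extension is anisotropic modulo `p`. -/
theorem dvd_of_dvd_normForm {ξ : (ZMod (p ^ e))ˣ} (hξ : p ≠ 2 → ¬ IsSquare (ξ : ZMod (p ^ e)))
    {s t : ZMod (p ^ e)}
    (h : (p : ZMod (p ^ e)) ∣ s ^ 2 + nsTrace p e * (s * t) - nsNorm ξ * t ^ 2) :
    (p : ZMod (p ^ e)) ∣ s ∧ (p : ZMod (p ^ e)) ∣ t := by
  by_cases hp : p = 2
  · subst hp
    simp only [nsTrace, nsNorm, if_true, one_mul] at h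
    have h1 : ¬ ((2 : ℕ) : ZMod (2 ^ e)) ∣ 1 := fun h => not_isUnit_of_dvd h isUnit_one
    rcases two_dvd_or_dvd_sub_one s with ⟨a, hs⟩ | ⟨a, hs⟩ <;>
      rcases two_dvd_or_dvd_sub_one t with ⟨b, ht⟩ | ⟨b, ht⟩
    · exact ⟨⟨a, hs⟩, ⟨b, ht⟩⟩
    · refine absurd ?_ h1
      have hd : ((2 : ℕ) : ZMod (2 ^ e)) ∣
          (s ^ 2 + s * t - t ^ 2) - (s * (s + t) - (t - 1) * (t + 1)) :=
        dvd_sub h (dvd_sub ⟨a * (s + t), by rw [hs]; ring⟩ ⟨b * (t + 1), by rw [ht]; ring⟩)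
      rw [← dvd_neg]
      convert hd using 1
      ring
    · refine absurd ?_ h1
      have hd : ((2 : ℕ) : ZMod (2 ^ e)) ∣
          (s ^ 2 + s * t - t ^ 2) - (t * (s - t) + (s - 1) * (s + 1)) :=
        dvd_sub h (dvd_add ⟨b * (s - t), by rw [ht]; ring⟩ ⟨a * (s + 1), by rw [hs]; ring⟩)
      convert hd using 1
      ring
    · refine absurd ?_ h1
      have hd : ((2 : ℕ) : ZMod (2 ^ e)) ∣ (s ^ 2 + s * t - t ^ 2) -
          ((s - 1) * (s + 1 + t) + (t - 1) - (t - 1) * (t + 1)) :=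
        dvd_sub h (dvd_sub (dvd_add ⟨a * (s + 1 + t), by rw [hs]; ring⟩ ⟨b, ht⟩)
          ⟨b * (t + 1), by rw [ht]; ring⟩)
      convert hd using 1
      ring
  · simp only [nsTrace, nsNorm, if_neg hp, zero_mul, add_zero] at h
    have ht : (p : ZMod (p ^ e)) ∣ t := by
      by_contra ht
      rw [← isUnit_iff_not_dvd] at ht
      obtain ⟨t, rfl⟩ := ht
      have hd : (p : ZMod (p ^ e)) ∣ ξ - (s * (t⁻¹).val) ^ 2 := by
        have := (h.mul_right ((t⁻¹).val ^ 2)).neg_right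
        convert this using 1
        have ht : t.val * (t⁻¹).val = 1 := t.mul_inv
        linear_combination (-(ξ : ZMod (p ^ e)) * (1 + t.val * (t⁻¹).val)) * ht
      refine hξ hp (isSquare_of_dvd_sub_sq hp ?_ hd)
      rw [isUnit_iff_not_dvd]
      intro hs
      exact not_isUnit_of_dvd
        ((dvd_sub_left (hs.trans (dvd_pow_self _ two_ne_zero))).mp hd) ξ.isUnit
    refine ⟨?_, ht⟩
    have hs : (p : ZMod (p ^ e)) ∣ s ^ 2 :=
      (dvd_sub_left ((ht.trans (dvd_pow_self _ two_ne_zero)).mul_left _)).mp h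
    rw [sq, prime_cast_dvd_mul, or_self] at hs
    exact hs

end

end CartanChen

/-! ### Fixed points on the cosets of the non-split Cartan subgroup -/

namespace CartanChen

section

variable {p e : ℕ} [Fact p.Prime] [NeZero e]

theorem exists_first_col {s t : ZMod (p ^ e)}
    (h : ¬ ((p : ZMod (p ^ e)) ∣ s ∧ (p : ZMod (p ^ e)) ∣ t)) :
    ∃ x : G p e, x.val 0 0 = s ∧ x.val 1 0 = t := by
  rw [not_and_or, ← isUnit_iff_not_dvd, ← isUnit_iff_not_dvd] at h
  rcases h with h | h
  · exact ⟨Matrix.GeneralLinearGroup.mk'' !![s, 0; t, 1] (by simpa using h), rfl, rfl⟩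
  · exact ⟨Matrix.GeneralLinearGroup.mk'' !![s, 1; t, 0] (by simpa using h), rfl, rfl⟩

theorem not_dvd_first_col (x : G p e) :
    ¬ ((p : ZMod (p ^ e)) ∣ x.val 0 0 ∧ (p : ZMod (p ^ e)) ∣ x.val 1 0) := by
  rintro ⟨h0, h1⟩
  apply not_dvd_det x
  rw [Matrix.det_fin_two]
  exact dvd_sub (h0.mul_right _) (h1.mul_left _)

/-- Matrices fixing the first basis vector form a set of representatives for `G / Cns`, since
`Cns` acts simply transitively on unimodular vectors. Through it, fixed points on `G / Cns`
become solutions of two congruences. -/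
theorem card_fixedBy_Cns {ξ : (ZMod (p ^ e))ˣ} (hξ : p ≠ 2 → ¬ IsSquare (ξ : ZMod (p ^ e)))
    {g : G p e} {k : ℕ} (hk : k ≤ e) {A B C : ZMod (p ^ e)} (h : IsMulForm g k A B C) :
    Nat.card (MulAction.fixedBy (G p e ⧸ Cns p e ξ) g) =
      Nat.card {v : ZMod (p ^ e) × ZMod (p ^ e) // IsUnit v.2 ∧
        (p : ZMod (p ^ e)) ^ (e - k) ∣ 2 * A * v.1 + B * v.2 - nsTrace p e * A ∧
        (p : ZMod (p ^ e)) ^ (e - k) ∣ binForm A B C v.1 v.2 + nsNorm ξ * A} := by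
  have hdet : ∀ x : G p e, IsUnit x.val.det := fun x =>
    (Matrix.isUnit_iff_isUnit_det _).mp x.isUnit
  rw [Subgroup.card_fixedBy_quotient_of_transversal _
    {x : G p e | x.val 0 0 = 1 ∧ x.val 1 0 = 0} ?_ ?_]
  · have key : ∀ x : G p e, x.val 0 0 = 1 → x.val 1 0 = 0 → (x⁻¹ * g * x ∈ Cns p e ξ ↔
        (p : ZMod (p ^ e)) ^ (e - k) ∣ 2 * A * x.val 0 1 + B * x.val 1 1 - nsTrace p e * A ∧
        (p : ZMod (p ^ e)) ^ (e - k) ∣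
          binForm A B C (x.val 0 1) (x.val 1 1) + nsNorm ξ * A) := by
      intro x h0 h1
      obtain ⟨w, h10, hd, h01⟩ := h.conj x
      rw [mem_Cns_iff, ← pow_dvd_pow_mul_iff hk le_rfl, ← pow_dvd_pow_mul_iff hk le_rfl,
        prime_pow_eq_zero, zero_dvd_iff, zero_dvd_iff, hd, h10,
        ← neg_inj (a := (x⁻¹ * g * x).val 0 1), h01, h0, h1, and_comm,
        ← w.isUnit.mul_right_eq_zero, ← sub_eq_zero,
        ← w.isUnit.mul_right_eq_zero (b := _ * (binForm _ _ _ _ _ + _)),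
        ← sub_eq_zero (b := -_)]
      simp only [binForm, binPolar]
      refine and_congr (Eq.congr_left ?_) (Eq.congr_left ?_) <;> ring
    refine Nat.card_congr (Equiv.ofBijective (fun x => ⟨(x.1.val 0 1, x.1.val 1 1), ?_, ?_⟩)
      ⟨?_, ?_⟩)
    · have := hdet x.1
      rw [Matrix.det_fin_two, x.2.1.1, x.2.1.2, one_mul, mul_zero, sub_zero] at this
      exact this
    · exact (key x.1 x.2.1.1 x.2.1.2).mp x.2.2
    · rintro ⟨x, ⟨hx0, hx1⟩, hx⟩ ⟨y, ⟨hy0, hy1⟩, hy⟩ hxy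
      have hxy := congrArg Subtype.val hxy
      obtain ⟨h0, h1⟩ := Prod.mk.inj hxy
      refine Subtype.ext (Units.ext ?_)
      change x.val = y.val
      rw [Matrix.eta_fin_two x.val, Matrix.eta_fin_two y.val, hx0, hx1, hy0, hy1, h0, h1]
    · rintro ⟨⟨s, t⟩, ht, hst⟩
      let x : G p e := Matrix.GeneralLinearGroup.mk'' !![1, s; 0, t] (by simpa using ht)
      exact ⟨⟨x, ⟨rfl, rfl⟩, (key x rfl rfl).mpr hst⟩, rfl⟩
  · rintro x ⟨hx0, hx1⟩ y ⟨hy0, hy1⟩ hxy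
    obtain ⟨z, rfl⟩ : ∃ z, y = x * z := ⟨x⁻¹ * y, by group⟩
    rw [inv_mul_cancel_left, mem_Cns_iff] at hxy
    rw [Units.val_mul, Matrix.mul_apply, Fin.sum_univ_two, hx0] at hy0
    rw [Units.val_mul, Matrix.mul_apply, Fin.sum_univ_two, hx1, zero_mul, zero_add] at hy1
    have hu := hdet x
    rw [Matrix.det_fin_two, hx0, hx1, mul_zero, sub_zero, one_mul] at hu
    have hz10 := hu.mul_right_eq_zero.mp hy1
    rw [hz10, mul_zero, add_zero, one_mul] at hy0
    obtain ⟨h1, h2⟩ := hxy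
    rw [hz10, mul_zero] at h1 h2
    have hz : z = 1 := by
      refine Units.ext ?_
      change z.val = 1
      rw [Matrix.eta_fin_two z.val, Matrix.one_fin_two, hz10, hy0, h1, sub_eq_zero.mp h2, hy0]
    rw [hz, mul_one]
  · intro x
    have hN : IsUnit ((x⁻¹).val 0 0 ^ 2 + nsTrace p e * ((x⁻¹).val 0 0 * (x⁻¹).val 1 0)
        - nsNorm ξ * (x⁻¹).val 1 0 ^ 2) := by
      rw [isUnit_iff_not_dvd]
      exact fun hd => not_dvd_first_col x⁻¹ (dvd_of_dvd_normForm hξ hd)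
    let h : G p e := Matrix.GeneralLinearGroup.mk'' !![(x⁻¹).val 0 0, nsNorm ξ * (x⁻¹).val 1 0;
      (x⁻¹).val 1 0, (x⁻¹).val 0 0 + nsTrace p e * (x⁻¹).val 1 0] (by
        rw [Matrix.det_fin_two_of]
        convert hN using 1
        ring)
    have hx : x.val * (x⁻¹).val = 1 := x.mul_inv
    have h0 := congrFun (congrFun hx 0) 0
    have h1 := congrFun (congrFun hx 1) 0
    rw [Matrix.mul_apply, Fin.sum_univ_two] at h0 h1
    refine ⟨h, mem_Cns_iff.mpr ⟨rfl, add_sub_cancel_left _ _⟩, ?_, ?_⟩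
    · rw [Units.val_mul, Matrix.mul_apply, Fin.sum_univ_two]
      exact h0
    · rw [Units.val_mul, Matrix.mul_apply, Fin.sum_univ_two]
      exact h1

/-- A scalar matrix fixes everything, so this is the index of `Cns`. -/
theorem card_fixedBy_Cns_of_scalar {ξ : (ZMod (p ^ e))ˣ}
    (hξ : p ≠ 2 → ¬ IsSquare (ξ : ZMod (p ^ e)))
    {g : G p e} {A B C : ZMod (p ^ e)} (h : IsMulForm g e A B C) :
    Nat.card (MulAction.fixedBy (G p e ⧸ Cns p e ξ) g) = p ^ e * (p ^ (e - 1) * (p - 1)) := by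
  rw [card_fixedBy_Cns hξ le_rfl h]
  simp only [Nat.sub_self, pow_zero, isUnit_one.dvd, and_true]
  rw [← card_units (p := p) (e := e), ← Nat.card_zmod (p ^ e), ← Nat.card_prod, Nat.card_zmod]
  refine Nat.card_congr (Equiv.ofBijective
    (fun v => ⟨(v.1.1, v.2.unit), trivial⟩ : _ → {_v : ZMod (p ^ e) × (ZMod (p ^ e))ˣ // True})
    ⟨?_, ?_⟩ |>.trans (Equiv.subtypeUnivEquiv fun _ => trivial))
  · rintro ⟨⟨s, t⟩, ht⟩ ⟨⟨s', t'⟩, ht'⟩ heq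
    have h := congrArg Subtype.val heq
    obtain ⟨h1, h2⟩ := Prod.mk.inj h
    exact Subtype.ext (Prod.ext h1 (congrArg Units.val h2))
  · rintro ⟨⟨s, t⟩, -⟩
    exact ⟨⟨(s, t), t.isUnit⟩, Subtype.ext (Prod.ext rfl (Units.ext rfl))⟩

/-- A conjugate of `g` in `Cns` would make the residual form `(A, B, C)` a multiple of the norm
form, which is anisotropic modulo `p`. If `(1, 0)` is a zero modulo `p`, the residual form would
vanish modulo `p`, and `g` would be scalar modulo `p ^ (k + 1)`. -/
theorem card_fixedBy_Cns_eq_zero {ξ : (ZMod (p ^ e))ˣ}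
    (hξ : p ≠ 2 → ¬ IsSquare (ξ : ZMod (p ^ e)))
    {g : G p e} {k : ℕ} (hk : k < e) {A B C : ZMod (p ^ e)} (h : IsMulForm g k A B C)
    (hA : (p : ZMod (p ^ e)) ∣ A) (hg : ¬ ∃ A B C, IsMulForm g (k + 1) A B C) :
    Nat.card (MulAction.fixedBy (G p e ⧸ Cns p e ξ) g) = 0 := by
  rw [card_fixedBy_Cns hξ hk.le h, Nat.card_eq_zero]
  left
  constructor
  rintro ⟨⟨s, t⟩, ht, h1, h2⟩
  have hpk : (p : ZMod (p ^ e)) ∣ (p : ZMod (p ^ e)) ^ (e - k) :=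
    dvd_pow_self _ (Nat.sub_pos_of_lt hk).ne'
  have h1 : (p : ZMod (p ^ e)) ∣ B * t := by
    have h3 : (p : ZMod (p ^ e)) ∣ A * (2 * s - nsTrace p e) := hA.mul_right _
    convert dvd_sub (hpk.trans h1) h3 using 1
    ring
  have htp := (isUnit_iff_not_dvd t).mp ht
  have hB : (p : ZMod (p ^ e)) ∣ B := (prime_cast_dvd_mul.mp h1).resolve_right htp
  have hC : (p : ZMod (p ^ e)) ∣ C := by
    have h3 : (p : ZMod (p ^ e)) ∣ A * (s ^ 2 + nsNorm ξ) + B * (s * t) :=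
      dvd_add (hA.mul_right _) (hB.mul_right _)
    have h4 : (p : ZMod (p ^ e)) ∣ C * t * t := by
      convert dvd_sub (hpk.trans h2) h3 using 1
      simp only [binForm]
      ring
    have := (prime_cast_dvd_mul.mp h4).resolve_right htp
    exact (prime_cast_dvd_mul.mp this).resolve_right htp
  obtain ⟨A, rfl⟩ := hA
  obtain ⟨B, rfl⟩ := hB
  obtain ⟨C, rfl⟩ := hC
  obtain ⟨h1, h2, h3⟩ := h
  exact hg ⟨A, B, C, by rw [h1]; ring, by rw [h2]; ring, by rw [h3]; ring⟩

theorem card_fixedBy_Cns_of_anisotropic {ξ : (ZMod (p ^ e))ˣ}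
    (hξ : p ≠ 2 → ¬ IsSquare (ξ : ZMod (p ^ e)))
    {g : G p e} {k : ℕ} (hk : k < e) {A B C : ZMod (p ^ e)} (h : IsMulForm g k A B C)
    (hF : ∀ s t, (p : ZMod (p ^ e)) ∣ binForm A B C s t →
      (p : ZMod (p ^ e)) ∣ s ∧ (p : ZMod (p ^ e)) ∣ t) :
    Nat.card (MulAction.fixedBy (G p e ⧸ Cns p e ξ) g) = 2 * p ^ (2 * k) := by
  rw [card_fixedBy_Cns hξ hk.le h]
  have hpk : (p : ZMod (p ^ e)) ∣ (p : ZMod (p ^ e)) ^ (e - k) :=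
    dvd_pow_self _ (Nat.sub_pos_of_lt hk).ne'
  have h1 : ¬ (p : ZMod (p ^ e)) ∣ 1 := fun h => not_isUnit_of_dvd h isUnit_one
  have hA : IsUnit A := by
    rw [isUnit_iff_not_dvd]
    exact fun hd => h1 (hF 1 0 (by simpa [binForm] using hd)).1
  have hC : IsUnit C := by
    rw [isUnit_iff_not_dvd]
    exact fun hd => h1 (hF 0 1 (by simpa [binForm] using hd)).2
  have hek : e - (e - k) = k := Nat.sub_sub_self hk.le
  -- In both cases an affine substitution turns the two congruences into a linear one for one
  -- variable and a quadratic one with two simple roots modulo `p` for the other.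
  suffices H : ∃ (r₁ r₂ : ZMod (p ^ e))
      (f : ZMod (p ^ e) × ZMod (p ^ e) → ZMod (p ^ e) × ZMod (p ^ e)),
      IsUnit (r₁ - r₂) ∧ Function.Injective f ∧ ∀ v, (IsUnit v.2 ∧
        (p : ZMod (p ^ e)) ^ (e - k) ∣ 2 * A * v.1 + B * v.2 - nsTrace p e * A ∧
        (p : ZMod (p ^ e)) ^ (e - k) ∣ binForm A B C v.1 v.2 + nsNorm ξ * A) ↔
        ((p : ZMod (p ^ e)) ^ (e - k) ∣ (f v).1 ∧
          (p : ZMod (p ^ e)) ^ (e - k) ∣ ((f v).2 - r₁) * ((f v).2 - r₂)) by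
    obtain ⟨r₁, r₂, f, hr, hf, hfv⟩ := H
    rw [Nat.card_congr ((Equiv.ofBijective f (Finite.injective_iff_bijective.mp hf)).subtypeEquiv
      (q := fun w => (p : ZMod (p ^ e)) ^ (e - k) ∣ w.1 ∧
        (p : ZMod (p ^ e)) ^ (e - k) ∣ (w.2 - r₁) * (w.2 - r₂)) hfv),
      Nat.card_congr (Equiv.subtypeProdEquivProd (p := fun m => (p : ZMod (p ^ e)) ^ (e - k) ∣ m)
        (q := fun t => (p : ZMod (p ^ e)) ^ (e - k) ∣ (t - r₁) * (t - r₂))), Nat.card_prod,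
      card_pow_dvd (Nat.sub_le _ _),
      card_pow_dvd_mul_of_isUnit_sub hr (Nat.sub_le _ _) (Nat.sub_pos_of_lt hk).ne', hek]
    ring
  by_cases hp : p = 2
  · subst hp
    have h2 : ((2 : ℕ) : ZMod (2 ^ e)) = 2 := by norm_cast
    have hB : IsUnit B := by
      rw [isUnit_iff_not_dvd]
      intro hd
      have hA' := (two_dvd_or_dvd_sub_one A).resolve_left ((isUnit_iff_not_dvd A).mp hA)
      have hC' := (two_dvd_or_dvd_sub_one C).resolve_left ((isUnit_iff_not_dvd C).mp hC)
      refine h1 (hF 1 1 ?_).1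
      have h3 := dvd_add (dvd_add (dvd_add hA' hd) hC') ⟨1, rfl⟩
      rw [h2] at h3 ⊢
      convert h3 using 1
      simp only [binForm]
      ring
    have hW : IsUnit (4 * A * C - B ^ 2) := by
      rw [isUnit_iff_not_dvd]
      intro hd
      have h3 : ((2 : ℕ) : ZMod (2 ^ e)) ∣ 4 * A * C := ⟨2 * A * C, by rw [h2]; ring⟩
      have h4 := (dvd_sub_right h3).mp hd
      rw [sq, prime_cast_dvd_mul, or_self] at h4
      exact (isUnit_iff_not_dvd B).mp hB h4
    have hAC : ((2 : ℕ) : ZMod (2 ^ e)) ∣ A * C + B ^ 2 := by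
      obtain ⟨a, ha⟩ := (two_dvd_or_dvd_sub_one (A * C)).resolve_left
        ((isUnit_iff_not_dvd _).mp (hA.mul hC))
      obtain ⟨b, hb⟩ := (two_dvd_or_dvd_sub_one (B ^ 2)).resolve_left
        ((isUnit_iff_not_dvd _).mp (hB.pow 2))
      refine ⟨a + b + 1, ?_⟩
      rw [h2] at ha hb ⊢
      linear_combination ha + hb
    obtain ⟨W, hW⟩ := hW
    obtain ⟨r, -, hr⟩ := exists_mul_add_sq_eq (u := -1) (w := -(W⁻¹).val * (A * C + B ^ 2))
      isUnit_one.neg (hAC.mul_left _)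
    have hWi : W.val * (W⁻¹).val = 1 := W.mul_inv
    refine ⟨r, 1 - r, fun v => (2 * A * v.1 + B * v.2 - A, v.1), ?_, ?_, ?_⟩
    · rw [isUnit_iff_not_dvd]
      intro hd
      refine h1 ?_
      have h3 : ((2 : ℕ) : ZMod (2 ^ e)) ∣ 2 * r := ⟨r, by rw [h2]⟩
      convert dvd_sub h3 hd using 1
      ring
    · rintro ⟨s, t⟩ ⟨s', t'⟩ hst
      obtain ⟨hm, rfl⟩ := Prod.mk.inj hst
      have : B * t = B * t' := by linear_combination hm
      rw [hB.mul_left_cancel this]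
    · rintro ⟨s, t⟩
      simp only [nsTrace, nsNorm, if_true, one_mul]
      have hid : B ^ 2 * (binForm A B C s t + A) = A * W * ((s - r) * (s - (1 - r))) +
          (2 * A * s + B * t - A) *
            (B ^ 2 * s + C * (2 * A * s + B * t - A) + 2 * C * A * (1 - 2 * s)) := by
        have hr' : (W : ZMod (2 ^ e)) * (r - r ^ 2) = A * C + B ^ 2 := by
          linear_combination (-W.val) * hr + (A * C + B ^ 2) * hWi
        rw [binForm]
        linear_combination (-A) * hr' - A * (s ^ 2 - s) * hW
      constructor
      · rintro ⟨ht, hm, hq⟩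
        refine ⟨hm, ?_⟩
        have h3 := hq.mul_left (B ^ 2)
        rw [hid] at h3
        exact ((hA.mul W.isUnit).dvd_mul_left).mp ((dvd_add_left (hm.mul_right _)).mp h3)
      · rintro ⟨hm, hq⟩
        refine ⟨?_, hm, ?_⟩
        · rw [isUnit_iff_not_dvd]
          intro ht
          refine (isUnit_iff_not_dvd A).mp hA ?_
          have h3 : ((2 : ℕ) : ZMod (2 ^ e)) ∣ 2 * A * s := ⟨A * s, by rw [h2]; ring⟩
          convert dvd_sub (dvd_add h3 (ht.mul_left B)) (hpk.trans hm) using 1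
          ring
        · refine ((hB.pow 2).dvd_mul_left).mp ?_
          rw [hid]
          exact dvd_add (hq.mul_left _) (hm.mul_right _)
  · have h2 : IsUnit (2 : ZMod (p ^ e)) := isUnit_two hp
    have hid : ∀ s t, (4 * A) * binForm A B C s t =
        (2 * A * s + B * t) ^ 2 - (B ^ 2 - 4 * A * C) * t ^ 2 := fun s t => by
      rw [binForm]
      ring
    have h4A : IsUnit (4 * A) := by
      convert (h2.mul h2).mul hA using 1
      ring
    have h2A : IsUnit (2 * A) := h2.mul hA
    -- A zero `(η - B, 2A)` would result from a square root `η` of the discriminant.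
    have hroot : ∀ η, ¬ (p : ZMod (p ^ e)) ∣ η ^ 2 - (B ^ 2 - 4 * A * C) := by
      intro η hη
      refine (isUnit_iff_not_dvd _).mp h2A (hF (η - B) (2 * A) (h4A.dvd_mul_left.mp ?_)).2
      rw [hid]
      convert hη.mul_left ((2 * A) ^ 2) using 1
      ring
    have hD : IsUnit (B ^ 2 - 4 * A * C) := by
      rw [isUnit_iff_not_dvd]
      intro hd
      exact hroot 0 (by simpa using hd.neg_right)
    have hDs : ¬ IsSquare (B ^ 2 - 4 * A * C) := by
      rintro ⟨η, hη⟩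
      exact hroot η (by rw [hη, sq, sub_self]; exact dvd_zero _)
    obtain ⟨η, hη⟩ := isSquare_mul_of_not_isSquare hp hD ξ.isUnit hDs (hξ hp)
    obtain ⟨D, hD'⟩ := hD
    rw [← hD'] at hη
    have hηu : IsUnit η := by
      have := D.isUnit.mul ξ.isUnit
      rw [hη, IsUnit.mul_iff, and_self] at this
      exact this
    have hDi : D.val * (D⁻¹).val = 1 := D.mul_inv
    have ht₀ : IsUnit (2 * A * η * (D⁻¹).val) := (h2A.mul hηu).mul (D⁻¹).isUnit
    set t₀ := 2 * A * η * (D⁻¹).val with ht₀_def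
    have hDt : D.val * t₀ ^ 2 = 4 * A ^ 2 * ξ := by
      rw [ht₀_def]
      linear_combination (-4 * A ^ 2 * D.val * (D⁻¹).val ^ 2) * hη +
        (4 * A ^ 2 * ξ * (D.val * (D⁻¹).val + 1)) * hDi
    refine ⟨t₀, -t₀, fun v => (2 * A * v.1 + B * v.2, v.2), ?_, ?_, ?_⟩
    · convert h2.mul ht₀ using 1
      ring
    · rintro ⟨s, t⟩ ⟨s', t'⟩ hst
      obtain ⟨hm, rfl⟩ := Prod.mk.inj hst
      have : 2 * A * s = 2 * A * s' := by linear_combination hm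
      rw [h2A.mul_left_cancel this]
    · rintro ⟨s, t⟩
      simp only [nsTrace, nsNorm, if_neg hp, zero_mul, sub_zero]
      have hid' : (4 * A) * (binForm A B C s t + ξ * A) =
          (2 * A * s + B * t) * (2 * A * s + B * t) - D * ((t - t₀) * (t - -t₀)) := by
        rw [mul_add, hid, ← hD']
        linear_combination -hDt
      constructor
      · rintro ⟨ht, hm, hq⟩
        refine ⟨hm, D.isUnit.dvd_mul_left.mp ?_⟩
        have h3 := hq.mul_left (4 * A)
        rw [hid'] at h3
        exact (dvd_sub_right (hm.mul_right _)).mp h3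
      · rintro ⟨hm, hq⟩
        refine ⟨?_, hm, h4A.dvd_mul_left.mp ?_⟩
        · rw [isUnit_iff_not_dvd]
          intro ht
          refine (isUnit_iff_not_dvd _).mp (ht₀.pow 2) ?_
          convert dvd_sub (ht.mul_left t) (hpk.trans hq) using 1
          ring
        · rw [hid']
          exact dvd_sub (hm.mul_right _) (hq.mul_left _)

end

end CartanChen

/-! ### Fixed points on the cosets of `T r` and `B r` -/

namespace CartanChen

section

variable {p e : ℕ}

/-- The index of `T r` in `GL₂(ℤ/pᵉℤ)`, for `r ≤ e`. -/
def indexT (p : ℕ) : ℕ → ℕ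
  | 0 => 1
  | r + 1 => (p + 1) * p ^ (2 * r + 1)

/-- The index of `B r` in `GL₂(ℤ/pᵉℤ)`, for `r < e`. -/
def indexB (p r : ℕ) : ℕ := (p + 1) * p ^ (2 * r)

/-- The permutation matrix exchanging the two basis vectors. -/
noncomputable def swapMatrix (p e : ℕ) : G p e :=
  Matrix.GeneralLinearGroup.mk'' !![0, 1; 1, 0] (by simp)

theorem swapMatrix_mul_apply (x : G p e) (j : Fin 2) :
    (swapMatrix p e * x).val 0 j = x.val 1 j ∧ (swapMatrix p e * x).val 1 j = x.val 0 j := by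
  have h : (swapMatrix p e).val = !![0, 1; 1, 0] := rfl
  simp [h, Matrix.mul_apply, Fin.sum_univ_two]

variable [Fact p.Prime]

theorem card_fixedBy_of_forall_mem {H : Subgroup (G p e)} {g : G p e}
    (h : ∀ x : G p e, x⁻¹ * g * x ∈ H) {n : ℕ} (hn : Nat.card H * n = Nat.card (G p e)) :
    Nat.card (MulAction.fixedBy (G p e ⧸ H) g) = n := by
  refine Nat.eq_of_mul_eq_mul_left (Nat.card_pos (α := H)) ?_
  rw [H.card_mul_card_fixedBy_quotient, hn]
  exact Nat.card_congr (Equiv.subtypeUnivEquiv h)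

theorem card_fixedBy_eq_zero {H : Subgroup (G p e)} {g : G p e}
    (h : ∀ x : G p e, x⁻¹ * g * x ∉ H) :
    Nat.card (MulAction.fixedBy (G p e ⧸ H) g) = 0 := by
  have h1 := H.card_mul_card_fixedBy_quotient g
  have : IsEmpty {x : G p e // x⁻¹ * g * x ∈ H} := ⟨fun x => h x.1 x.2⟩
  rw [Nat.card_eq_zero.mpr (Or.inl this)] at h1
  exact (mul_eq_zero.mp h1).resolve_left (Nat.card_pos (α := H)).ne'

variable [NeZero e]

theorem isUnit_diag_of_dvd {x : G p e} (h : (p : ZMod (p ^ e)) ∣ x.val 1 0) :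
    IsUnit (x.val 0 0) ∧ IsUnit (x.val 1 1) := by
  have hu : IsUnit x.val.det := (Matrix.isUnit_iff_isUnit_det _).mp x.isUnit
  rw [← IsUnit.mul_iff, isUnit_iff_not_dvd]
  rw [isUnit_iff_not_dvd, Matrix.det_fin_two] at hu
  exact fun hd => hu (dvd_sub hd (h.mul_left _))

theorem isUnit_antidiag_of_dvd {x : G p e} (h : (p : ZMod (p ^ e)) ∣ x.val 0 0) :
    IsUnit (x.val 1 0) ∧ IsUnit (x.val 0 1) := by
  have hu : IsUnit x.val.det := (Matrix.isUnit_iff_isUnit_det _).mp x.isUnit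
  rw [and_comm, ← IsUnit.mul_iff, isUnit_iff_not_dvd]
  rw [isUnit_iff_not_dvd, Matrix.det_fin_two] at hu
  exact fun hd => hu (dvd_sub (h.mul_right _) hd)

theorem injective_add_mul_add_sq {a b c : ZMod (p ^ e)} (hb : IsUnit b) :
    Function.Injective fun t => a + b * t + p * c * t ^ 2 := by
  intro t t' h
  have hu : IsUnit (b + p * (c * (t + t'))) := by
    rw [isUnit_iff_not_dvd] at hb ⊢
    exact fun hd => hb ((dvd_add_left (dvd_mul_right _ _)).mp hd)
  have h0 : (b + p * (c * (t + t'))) * (t - t') = 0 := by linear_combination h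
  exact sub_eq_zero.mp (hu.mul_right_eq_zero.mp h0)

/-- Replacing the off-diagonal entries of a matrix by the values of the form on its columns is a
bijective change of variables near the diagonal, so the congruences become linear. -/
theorem card_diag (A C : ZMod (p ^ e)) {E : ZMod (p ^ e)} (hE : IsUnit E) {i j : ℕ} (hj0 : j ≠ 0)
    (hj : j ≤ e) (hi : i ≤ e) :
    Nat.card {x : G p e // (IsUnit (x.val 0 0) ∧ IsUnit (x.val 1 1)) ∧
      (p : ZMod (p ^ e)) ^ j ∣ binForm (p * A) E (p * C) (x.val 0 0) (x.val 1 0) ∧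
      (p : ZMod (p ^ e)) ^ i ∣ binForm (p * A) E (p * C) (x.val 0 1) (x.val 1 1)} =
    Nat.card (ZMod (p ^ e))ˣ ^ 2 * (p ^ (e - j) * p ^ (e - i)) := by
  have hF1 : ∀ s t, binForm (p * A) E (p * C) s t =
      p * A * s ^ 2 + (E * s) * t + p * C * t ^ 2 := fun s t => by rw [binForm]; ring
  have hF2 : ∀ s t, binForm (p * A) E (p * C) s t =
      p * C * t ^ 2 + (E * t) * s + p * A * s ^ 2 := fun s t => by rw [binForm]; ring
  have inj1 : ∀ s, IsUnit s → Function.Injective fun t => binForm (p * A) E (p * C) s t := by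
    intro s hs
    simp only [hF1]
    exact injective_add_mul_add_sq (hE.mul hs)
  have inj2 : ∀ t, IsUnit t → Function.Injective fun s => binForm (p * A) E (p * C) s t := by
    intro t ht
    simp only [hF2]
    exact injective_add_mul_add_sq (hE.mul ht)
  rw [sq, ← card_pow_dvd (p := p) hj, ← card_pow_dvd (p := p) hi, ← Nat.card_prod, ← Nat.card_prod,
    ← Nat.card_prod]
  refine Nat.card_congr (Equiv.ofBijective
    (fun x => ((x.2.1.1.unit, x.2.1.2.unit), ⟨_, x.2.2.1⟩, ⟨_, x.2.2.2⟩)) ⟨?_, ?_⟩)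
  · rintro ⟨x, ⟨hx0, hx1⟩, hx⟩ ⟨y, ⟨hy0, hy1⟩, hy⟩ h
    obtain ⟨hu, hv⟩ := Prod.mk.inj h
    obtain ⟨h00, h11⟩ := Prod.mk.inj hu
    obtain ⟨h10, h01⟩ := Prod.mk.inj hv
    have h00 : x.val 0 0 = y.val 0 0 := congrArg Units.val h00
    have h11 : x.val 1 1 = y.val 1 1 := congrArg Units.val h11
    have h10 := congrArg Subtype.val h10
    have h01 := congrArg Subtype.val h01
    simp only [← h00, ← h11] at h10 h01
    refine Subtype.ext (Units.ext ?_)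
    change x.val = y.val
    rw [Matrix.eta_fin_two x.val, Matrix.eta_fin_two y.val, h00, h11, inj1 _ hx0 h10,
      inj2 _ hx1 h01]
  · rintro ⟨⟨s, t⟩, ⟨m, hm⟩, ⟨n, hn⟩⟩
    obtain ⟨u, hu⟩ := Finite.injective_iff_surjective.mp (inj1 s s.isUnit) m
    obtain ⟨v, hv⟩ := Finite.injective_iff_surjective.mp (inj2 t t.isUnit) n
    subst hu hv
    have hpu : (p : ZMod (p ^ e)) ∣ u := by
      have h1 : (p : ZMod (p ^ e)) ∣ binForm (p * A) E (p * C) s.val u :=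
        (dvd_pow_self (p : ZMod (p ^ e)) hj0).trans hm
      have h2 : (p : ZMod (p ^ e)) ∣ p * (A * s.val ^ 2 + C * u ^ 2) := dvd_mul_right _ _
      refine (hE.mul s.isUnit).dvd_mul_left.mp ?_
      convert dvd_sub h1 h2 using 1
      rw [binForm]
      ring
    let x : G p e := Matrix.GeneralLinearGroup.mk'' !![s.val, v; u, t.val] (by
      rw [Matrix.det_fin_two_of, isUnit_iff_not_dvd]
      intro hd
      refine (isUnit_iff_not_dvd _).mp (s.isUnit.mul t.isUnit) ?_
      exact (dvd_sub_left (hpu.mul_left v)).mp hd)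
    exact ⟨⟨x, ⟨s.isUnit, t.isUnit⟩, hm, hn⟩,
      Prod.ext (Prod.ext (Units.ext rfl) (Units.ext rfl)) rfl⟩

/-- The analogue of `card_diag` near the antidiagonal, obtained by exchanging the rows. -/
theorem card_antidiag (A C : ZMod (p ^ e)) {E : ZMod (p ^ e)} (hE : IsUnit E) {i j : ℕ}
    (hj0 : j ≠ 0) (hj : j ≤ e) (hi : i ≤ e) :
    Nat.card {x : G p e // (IsUnit (x.val 1 0) ∧ IsUnit (x.val 0 1)) ∧
      (p : ZMod (p ^ e)) ^ j ∣ binForm (p * A) E (p * C) (x.val 0 0) (x.val 1 0) ∧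
      (p : ZMod (p ^ e)) ^ i ∣ binForm (p * A) E (p * C) (x.val 0 1) (x.val 1 1)} =
    Nat.card (ZMod (p ^ e))ˣ ^ 2 * (p ^ (e - j) * p ^ (e - i)) := by
  rw [← card_diag C A hE hj0 hj hi]
  have hsymm : ∀ s t, binForm (p * A) E (p * C) s t = binForm (p * C) E (p * A) t s :=
    fun s t => by simp only [binForm]; ring
  refine Nat.card_congr ((Equiv.mulLeft (swapMatrix p e)).subtypeEquiv fun x => ?_)
  rw [Equiv.coe_mulLeft, (swapMatrix_mul_apply x 0).1, (swapMatrix_mul_apply x 1).1,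
    (swapMatrix_mul_apply x 0).2, (swapMatrix_mul_apply x 1).2, hsymm, hsymm]

/-- A form with the two distinct roots `(1 : 0)` and `(0 : 1)` modulo `p`: both columns of `x` must
reduce to roots, and different ones, so `x` is diagonal or antidiagonal modulo `p`. -/
theorem card_dvd_binForm (A C : ZMod (p ^ e)) {E : ZMod (p ^ e)} (hE : IsUnit E) {i j : ℕ}
    (hj0 : j ≠ 0) (hj : j ≤ e) (hi : i ≤ e) :
    Nat.card {x : G p e //
      (p : ZMod (p ^ e)) ^ j ∣ binForm (p * A) E (p * C) (x.val 0 0) (x.val 1 0) ∧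
      (p : ZMod (p ^ e)) ^ i ∣ binForm (p * A) E (p * C) (x.val 0 1) (x.val 1 1)} =
    2 * (Nat.card (ZMod (p ^ e))ˣ ^ 2 * (p ^ (e - j) * p ^ (e - i))) := by
  have hiff : ∀ x : G p e,
      ((p : ZMod (p ^ e)) ^ j ∣ binForm (p * A) E (p * C) (x.val 0 0) (x.val 1 0) ∧
      (p : ZMod (p ^ e)) ^ i ∣ binForm (p * A) E (p * C) (x.val 0 1) (x.val 1 1)) ↔
      ((IsUnit (x.val 0 0) ∧ IsUnit (x.val 1 1)) ∧
        (p : ZMod (p ^ e)) ^ j ∣ binForm (p * A) E (p * C) (x.val 0 0) (x.val 1 0) ∧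
        (p : ZMod (p ^ e)) ^ i ∣ binForm (p * A) E (p * C) (x.val 0 1) (x.val 1 1)) ∨
      ((IsUnit (x.val 1 0) ∧ IsUnit (x.val 0 1)) ∧
        (p : ZMod (p ^ e)) ^ j ∣ binForm (p * A) E (p * C) (x.val 0 0) (x.val 1 0) ∧
        (p : ZMod (p ^ e)) ^ i ∣ binForm (p * A) E (p * C) (x.val 0 1) (x.val 1 1)) := by
    intro x
    refine ⟨fun h => ?_, fun h => h.elim And.right And.right⟩
    have h1 : (p : ZMod (p ^ e)) ∣ E * (x.val 0 0 * x.val 1 0) := by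
      have h2 : (p : ZMod (p ^ e)) ∣ p * (A * x.val 0 0 ^ 2 + C * x.val 1 0 ^ 2) :=
        dvd_mul_right _ _
      convert dvd_sub ((dvd_pow_self (p : ZMod (p ^ e)) hj0).trans h.1) h2 using 1
      rw [binForm]
      ring
    rcases prime_cast_dvd_mul.mp (hE.dvd_mul_left.mp h1) with h3 | h3
    · exact Or.inr ⟨isUnit_antidiag_of_dvd h3, h⟩
    · exact Or.inl ⟨isUnit_diag_of_dvd h3, h⟩
  have hdisj : Disjoint
      (fun x : G p e => (IsUnit (x.val 0 0) ∧ IsUnit (x.val 1 1)) ∧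
        (p : ZMod (p ^ e)) ^ j ∣ binForm (p * A) E (p * C) (x.val 0 0) (x.val 1 0) ∧
        (p : ZMod (p ^ e)) ^ i ∣ binForm (p * A) E (p * C) (x.val 0 1) (x.val 1 1))
      (fun x : G p e => (IsUnit (x.val 1 0) ∧ IsUnit (x.val 0 1)) ∧
        (p : ZMod (p ^ e)) ^ j ∣ binForm (p * A) E (p * C) (x.val 0 0) (x.val 1 0) ∧
        (p : ZMod (p ^ e)) ^ i ∣ binForm (p * A) E (p * C) (x.val 0 1) (x.val 1 1)) := by
    rw [Pi.disjoint_iff]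
    intro x
    rw [Prop.disjoint_iff, not_and]
    rintro ⟨⟨h0, -⟩, h⟩ ⟨⟨h1, -⟩, -⟩
    refine (isUnit_iff_not_dvd _).mp (hE.mul (h0.mul h1)) ?_
    have h2 : (p : ZMod (p ^ e)) ∣ p * (A * x.val 0 0 ^ 2 + C * x.val 1 0 ^ 2) := dvd_mul_right _ _
    convert dvd_sub ((dvd_pow_self (p : ZMod (p ^ e)) hj0).trans h.1) h2 using 1
    rw [binForm]
    ring
  classical
  rw [Nat.card_congr (Equiv.subtypeEquivRight hiff), Nat.card_eq_fintype_card,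
    Fintype.card_subtype_or_disjoint _ _ hdisj, ← Nat.card_eq_fintype_card,
    ← Nat.card_eq_fintype_card, card_diag A C hE hj0 hj hi, card_antidiag A C hE hj0 hj hi, two_mul]

/-- `B r` is the set counted by `card_diag` for the form `s t`. -/
theorem card_B {r : ℕ} (hr : r < e) :
    Nat.card (B p e r) = Nat.card (ZMod (p ^ e))ˣ ^ 2 * (p ^ (e - (r + 1)) * p ^ (e - r)) := by
  rw [← card_diag (0 : ZMod (p ^ e)) 0 isUnit_one r.succ_ne_zero hr hr.le]
  refine Nat.card_congr (Equiv.subtypeEquivRight fun x => ?_)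
  simp only [mem_B_iff, binForm, mul_zero, zero_mul, zero_add, add_zero, one_mul]
  constructor
  · rintro ⟨h1, h2⟩
    exact ⟨isUnit_diag_of_dvd ((dvd_pow_self _ r.succ_ne_zero).trans h2), h2.mul_left _,
      h1.mul_right _⟩
  · rintro ⟨⟨h0, h1⟩, h2, h3⟩
    exact ⟨h1.dvd_mul_right.mp h3, h0.dvd_mul_left.mp h2⟩

/-- `T r` is the set counted by `card_diag` for the form `s t`. -/
theorem card_T {r : ℕ} (hr0 : r ≠ 0) (hr : r ≤ e) :
    Nat.card (T p e r) = Nat.card (ZMod (p ^ e))ˣ ^ 2 * (p ^ (e - r) * p ^ (e - r)) := by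
  rw [← card_diag (0 : ZMod (p ^ e)) 0 isUnit_one hr0 hr hr]
  refine Nat.card_congr (Equiv.subtypeEquivRight fun x => ?_)
  simp only [mem_T_iff, binForm, mul_zero, zero_mul, zero_add, add_zero, one_mul]
  constructor
  · rintro ⟨h1, h2⟩
    exact ⟨isUnit_diag_of_dvd ((dvd_pow_self _ hr0).trans h2), h2.mul_left _, h1.mul_right _⟩
  · rintro ⟨⟨h0, h1⟩, h2, h3⟩
    exact ⟨h1.dvd_mul_right.mp h3, h0.dvd_mul_left.mp h2⟩

/-- The matrices with non-unit upper left entry are the translate of `B 0` by the swap matrix; the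
others are determined by that entry, the off-diagonal entries and the determinant. -/
theorem card_G : Nat.card (G p e) =
    Nat.card (ZMod (p ^ e))ˣ ^ 2 * (p ^ e * p ^ e + p ^ (e - 1) * p ^ e) := by
  have h1 : Nat.card {x : G p e // IsUnit (x.val 0 0)} =
      Nat.card (ZMod (p ^ e))ˣ ^ 2 * (p ^ e * p ^ e) := by
    have hR : Nat.card (ZMod (p ^ e)) = p ^ e := Nat.card_zmod _
    conv_rhs => rw [sq, ← hR, ← Nat.card_prod, ← Nat.card_prod, ← Nat.card_prod, hR]
    refine Nat.card_congr (Equiv.ofBijective (fun x => ((x.2.unit,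
      ((Matrix.isUnit_iff_isUnit_det _).mp x.1.isUnit).unit), x.1.val 0 1, x.1.val 1 0)) ⟨?_, ?_⟩)
    · rintro ⟨x, hx⟩ ⟨y, hy⟩ h
      obtain ⟨hu, hv⟩ := Prod.mk.inj h
      obtain ⟨h00, hdet⟩ := Prod.mk.inj hu
      obtain ⟨h01, h10⟩ := Prod.mk.inj hv
      have h00 : x.val 0 0 = y.val 0 0 := congrArg Units.val h00
      have hdet : x.val.det = y.val.det := congrArg Units.val hdet
      have h01 : x.val 0 1 = y.val 0 1 := h01
      have h10 : x.val 1 0 = y.val 1 0 := h10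
      rw [Matrix.det_fin_two, Matrix.det_fin_two, ← h00, h01, h10, sub_left_inj] at hdet
      refine Subtype.ext (Units.ext ?_)
      change x.val = y.val
      rw [Matrix.eta_fin_two x.val, Matrix.eta_fin_two y.val, hx.mul_left_cancel hdet, h00, h01,
        h10]
    · rintro ⟨⟨s, d⟩, b, c⟩
      have hs : s.val * (s⁻¹).val = 1 := s.mul_inv
      have hd : (!![s.val, b; c, (s⁻¹).val * (d.val + b * c)]).det = d.val := by
        rw [Matrix.det_fin_two_of]
        linear_combination (d.val + b * c) * hs
      let x : G p e := Matrix.GeneralLinearGroup.mk'' _ (hd.symm ▸ d.isUnit)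
      exact ⟨⟨x, s.isUnit⟩, Prod.ext (Prod.ext (Units.ext rfl) (Units.ext hd)) rfl⟩
  have h2 : Nat.card {x : G p e // ¬ IsUnit (x.val 0 0)} =
      Nat.card (ZMod (p ^ e))ˣ ^ 2 * (p ^ (e - 1) * p ^ e) := by
    have hB := card_B (p := p) (Nat.pos_of_ne_zero (NeZero.ne e))
    rw [zero_add, Nat.sub_zero] at hB
    rw [← hB]
    refine Nat.card_congr ((Equiv.mulLeft (swapMatrix p e)).subtypeEquiv fun x => ?_)
    rw [Equiv.coe_mulLeft, mem_B_iff, pow_zero, zero_add, pow_one, (swapMatrix_mul_apply x 0).2,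
      isUnit_iff_not_dvd, not_not]
    exact (and_iff_right (one_dvd _)).symm
  classical
  rw [mul_add, ← h1, ← h2, Nat.card_eq_fintype_card, Nat.card_eq_fintype_card,
    Nat.card_eq_fintype_card, Fintype.card_subtype_compl]
  exact (Nat.add_sub_of_le (Fintype.card_subtype_le _)).symm

section fixedPoints

variable {g : G p e} {k : ℕ} {A C E : ZMod (p ^ e)}

theorem conj_mem_T_iff (h : IsMulForm g k A E C) {r : ℕ} (x : G p e) :
    x⁻¹ * g * x ∈ T p e r ↔
      (p : ZMod (p ^ e)) ^ r ∣ (p : ZMod (p ^ e)) ^ k * binForm A E C (x.val 0 0) (x.val 1 0) ∧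
      (p : ZMod (p ^ e)) ^ r ∣ (p : ZMod (p ^ e)) ^ k * binForm A E C (x.val 0 1) (x.val 1 1) := by
  obtain ⟨w, h1, -, h3⟩ := h.conj x
  rw [mem_T_iff, and_comm, h1, ← dvd_neg (b := (x⁻¹ * g * x).val 0 1), h3, mul_left_comm,
    w.isUnit.dvd_mul_left, mul_left_comm, w.isUnit.dvd_mul_left]

theorem conj_mem_B_iff (h : IsMulForm g k A E C) {r : ℕ} (x : G p e) :
    x⁻¹ * g * x ∈ B p e r ↔
      (p : ZMod (p ^ e)) ^ (r + 1) ∣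
        (p : ZMod (p ^ e)) ^ k * binForm A E C (x.val 0 0) (x.val 1 0) ∧
      (p : ZMod (p ^ e)) ^ r ∣ (p : ZMod (p ^ e)) ^ k * binForm A E C (x.val 0 1) (x.val 1 1) := by
  obtain ⟨w, h1, -, h3⟩ := h.conj x
  rw [mem_B_iff, and_comm, h1, ← dvd_neg (b := (x⁻¹ * g * x).val 0 1), h3, mul_left_comm,
    w.isUnit.dvd_mul_left, mul_left_comm, w.isUnit.dvd_mul_left]

theorem card_T_mul_indexT {r : ℕ} (hr : r ≤ e) :
    Nat.card (T p e r) * indexT p r = Nat.card (G p e) := by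
  rcases r with _ | r
  · rw [indexT, mul_one]
    refine Nat.card_congr (Equiv.subtypeUnivEquiv fun x => ?_)
    rw [mem_T_iff, pow_zero]
    exact ⟨one_dvd _, one_dvd _⟩
  · rw [card_T r.succ_ne_zero hr, card_G, indexT, mul_assoc]
    congr 1
    obtain ⟨m, hm⟩ := Nat.exists_eq_add_of_le hr
    rw [show e - (r + 1) = m by omega, show e - 1 = r + m by omega,
      show p ^ e = p ^ (r + 1 + m) by rw [← hm]]
    ring

theorem card_B_mul_indexB {r : ℕ} (hr : r < e) :
    Nat.card (B p e r) * indexB p r = Nat.card (G p e) := by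
  rw [card_B hr, card_G, indexB, mul_assoc]
  congr 1
  obtain ⟨m, hm⟩ := Nat.exists_eq_add_of_lt hr
  rw [show e - (r + 1) = m by omega, show e - r = m + 1 by omega, show e - 1 = r + m by omega,
    show p ^ e = p ^ (r + m + 1) by rw [← hm]]
  ring

theorem card_fixedBy_T_of_le (h : IsMulForm g k A E C) {r : ℕ} (hr : r ≤ k) (hk : k ≤ e) :
    Nat.card (MulAction.fixedBy (G p e ⧸ T p e r) g) = indexT p r :=
  card_fixedBy_of_forall_mem (fun x => (conj_mem_T_iff h x).mpr
    ⟨(pow_dvd_pow _ hr).mul_right _, (pow_dvd_pow _ hr).mul_right _⟩)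
    (card_T_mul_indexT (hr.trans hk))

theorem card_fixedBy_B_of_lt (h : IsMulForm g k A E C) {r : ℕ} (hr : r < k) (hk : k ≤ e) :
    Nat.card (MulAction.fixedBy (G p e ⧸ B p e r) g) = indexB p r :=
  card_fixedBy_of_forall_mem (fun x => (conj_mem_B_iff h x).mpr
    ⟨(pow_dvd_pow _ hr).mul_right _, (pow_dvd_pow _ hr.le).mul_right _⟩)
    (card_B_mul_indexB (hr.trans_le hk))

theorem card_fixedBy_T_of_split (h : IsMulForm g k (p * A) E (p * C)) (hE : IsUnit E) {r : ℕ}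
    (hkr : k < r) (hr : r ≤ e) :
    Nat.card (MulAction.fixedBy (G p e ⧸ T p e r) g) = 2 * p ^ (2 * k) := by
  refine Nat.eq_of_mul_eq_mul_left (Nat.card_pos (α := T p e r)) ?_
  have h2 : ∀ x : G p e, x⁻¹ * g * x ∈ T p e r ↔
      (p : ZMod (p ^ e)) ^ (r - k) ∣ binForm (p * A) E (p * C) (x.val 0 0) (x.val 1 0) ∧
      (p : ZMod (p ^ e)) ^ (r - k) ∣ binForm (p * A) E (p * C) (x.val 0 1) (x.val 1 1) := by
    intro x
    rw [conj_mem_T_iff h, pow_dvd_pow_mul_iff hkr.le hr, pow_dvd_pow_mul_iff hkr.le hr]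
  rw [Subgroup.card_mul_card_fixedBy_quotient, Nat.card_congr (Equiv.subtypeEquivRight h2),
    card_dvd_binForm A C hE (Nat.sub_pos_of_lt hkr).ne' ((Nat.sub_le _ _).trans hr)
      ((Nat.sub_le _ _).trans hr), card_T (Nat.ne_zero_of_lt hkr) hr,
    show e - (r - k) = e - r + k by omega]
  ring

theorem card_fixedBy_B_of_split (h : IsMulForm g k (p * A) E (p * C)) (hE : IsUnit E) {r : ℕ}
    (hkr : k ≤ r) (hr : r < e) :
    Nat.card (MulAction.fixedBy (G p e ⧸ B p e r) g) = 2 * p ^ (2 * k) := by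
  refine Nat.eq_of_mul_eq_mul_left (Nat.card_pos (α := B p e r)) ?_
  have h2 : ∀ x : G p e, x⁻¹ * g * x ∈ B p e r ↔
      (p : ZMod (p ^ e)) ^ (r + 1 - k) ∣ binForm (p * A) E (p * C) (x.val 0 0) (x.val 1 0) ∧
      (p : ZMod (p ^ e)) ^ (r - k) ∣ binForm (p * A) E (p * C) (x.val 0 1) (x.val 1 1) := by
    intro x
    rw [conj_mem_B_iff h, pow_dvd_pow_mul_iff (hkr.trans r.le_succ) hr,
      pow_dvd_pow_mul_iff hkr hr.le]
  rw [Subgroup.card_mul_card_fixedBy_quotient, Nat.card_congr (Equiv.subtypeEquivRight h2),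
    card_dvd_binForm A C hE (by omega) (by omega) (by omega), card_B hr,
    show e - (r + 1 - k) = e - (r + 1) + k by omega, show e - (r - k) = e - r + k by omega]
  ring

theorem dvd_binForm_of_conj_mem_T (h : IsMulForm g k A E C) {r : ℕ} (hkr : k < r) (hr : r ≤ e)
    {x : G p e} (hx : x⁻¹ * g * x ∈ T p e r) :
    (p : ZMod (p ^ e)) ∣ binForm A E C (x.val 0 0) (x.val 1 0) ∧
      (p : ZMod (p ^ e)) ∣ binForm A E C (x.val 0 1) (x.val 1 1) := by
  rw [conj_mem_T_iff h, pow_dvd_pow_mul_iff hkr.le hr, pow_dvd_pow_mul_iff hkr.le hr] at hx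
  have h0 := dvd_pow_self (p : ZMod (p ^ e)) (Nat.sub_pos_of_lt hkr).ne'
  exact ⟨h0.trans hx.1, h0.trans hx.2⟩

theorem card_fixedBy_T_of_anisotropic (h : IsMulForm g k A E C)
    (hF : ∀ s t, (p : ZMod (p ^ e)) ∣ binForm A E C s t →
      (p : ZMod (p ^ e)) ∣ s ∧ (p : ZMod (p ^ e)) ∣ t) {r : ℕ} (hkr : k < r) (hr : r ≤ e) :
    Nat.card (MulAction.fixedBy (G p e ⧸ T p e r) g) = 0 :=
  card_fixedBy_eq_zero fun x hx =>
    not_dvd_first_col x (hF _ _ (dvd_binForm_of_conj_mem_T h hkr hr hx).1)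

theorem card_fixedBy_B_of_anisotropic (h : IsMulForm g k A E C)
    (hF : ∀ s t, (p : ZMod (p ^ e)) ∣ binForm A E C s t →
      (p : ZMod (p ^ e)) ∣ s ∧ (p : ZMod (p ^ e)) ∣ t) {r : ℕ} (hkr : k ≤ r) (hr : r < e) :
    Nat.card (MulAction.fixedBy (G p e ⧸ B p e r) g) = 0 := by
  refine card_fixedBy_eq_zero fun x hx => not_dvd_first_col x (hF _ _ ?_)
  rw [conj_mem_B_iff h, pow_dvd_pow_mul_iff (hkr.trans r.le_succ) hr] at hx
  exact (dvd_pow_self _ (by omega)).trans hx.1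

theorem dvd_binForm_iff_of_isUnit (hC : IsUnit C) (s t : ZMod (p ^ e)) :
    (p : ZMod (p ^ e)) ∣ binForm (p * A) (p * E) C s t ↔ (p : ZMod (p ^ e)) ∣ t := by
  have h : binForm (p * A) (p * E) C s t = p * (A * s ^ 2 + E * (s * t)) + C * t ^ 2 := by
    rw [binForm]
    ring
  rw [h, dvd_add_right (dvd_mul_right _ _), hC.dvd_mul_left, sq, prime_cast_dvd_mul, or_self]

theorem card_fixedBy_T_of_ramified (h : IsMulForm g k (p * A) (p * E) C) (hC : IsUnit C) {r : ℕ}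
    (hkr : k < r) (hr : r ≤ e) : Nat.card (MulAction.fixedBy (G p e ⧸ T p e r) g) = 0 := by
  refine card_fixedBy_eq_zero fun x hx => ?_
  obtain ⟨h1, h2⟩ := dvd_binForm_of_conj_mem_T h hkr hr hx
  rw [dvd_binForm_iff_of_isUnit hC] at h1 h2
  exact (isUnit_iff_not_dvd _).mp (isUnit_diag_of_dvd h1).2 h2

theorem card_fixedBy_B_of_ramified_of_lt (h : IsMulForm g k (p * A) (p * E) C) (hC : IsUnit C)
    {r : ℕ} (hkr : k < r) (hr : r < e) :
    Nat.card (MulAction.fixedBy (G p e ⧸ B p e r) g) = 0 := by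
  refine card_fixedBy_eq_zero fun x hx => ?_
  rw [conj_mem_B_iff h, pow_dvd_pow_mul_iff (hkr.le.trans r.le_succ) hr,
    pow_dvd_pow_mul_iff hkr.le hr.le] at hx
  have h1 := (dvd_pow_self (p : ZMod (p ^ e)) (show r + 1 - k ≠ 0 by omega)).trans hx.1
  have h2 := (dvd_pow_self (p : ZMod (p ^ e)) (show r - k ≠ 0 by omega)).trans hx.2
  rw [dvd_binForm_iff_of_isUnit hC] at h1 h2
  exact (isUnit_iff_not_dvd _).mp (isUnit_diag_of_dvd h1).2 h2

theorem card_fixedBy_B_of_ramified (h : IsMulForm g k (p * A) (p * E) C) (hC : IsUnit C)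
    (hk : k < e) : Nat.card (MulAction.fixedBy (G p e ⧸ B p e k) g) = p ^ (2 * k) := by
  refine Nat.eq_of_mul_eq_mul_left (Nat.card_pos (α := B p e k)) ?_
  have h2 : ∀ x : G p e, x⁻¹ * g * x ∈ B p e k ↔ x ∈ B p e 0 := by
    intro x
    rw [conj_mem_B_iff h, pow_dvd_pow_mul_iff (Nat.le_add_right k 1) hk, Nat.add_sub_cancel_left,
      pow_one,
      dvd_binForm_iff_of_isUnit hC, mem_B_iff, pow_zero, zero_add, pow_one, and_comm]
    exact and_congr_left fun _ => iff_of_true (dvd_mul_right _ _) (one_dvd _)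
  rw [Subgroup.card_mul_card_fixedBy_quotient, Nat.card_congr (Equiv.subtypeEquivRight h2)]
  refine (card_B (Nat.pos_of_ne_zero (NeZero.ne e))).trans ?_
  rw [card_B hk, mul_assoc]
  congr 1
  rw [show e - (0 + 1) = e - (k + 1) + k by omega, show e - 0 = e - k + k by omega]
  ring

end fixedPoints

end

end CartanChen

/-! ### The fixed point identity and the isomorphism -/

namespace CartanChen

section

/-- A telescoping sum: `indexT p (r + 1) - indexB p r = p ^ (2 * (r + 1)) - p ^ (2 * r)`. -/
theorem sum_indexB_add_pow (p k : ℕ) :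
    ∑ r ∈ Finset.range k, indexB p r + p ^ (2 * k) = ∑ r ∈ Finset.range (k + 1), indexT p r := by
  induction k with
  | zero => rfl
  | succ k ih =>
    rw [Finset.sum_range_succ, Finset.sum_range_succ _ (k + 1), ← ih, indexB, indexT]
    ring

/-- The counting identity when `n`, `b r`, `t r` are the fixed point numbers on the cosets of `Cns`,
`B r`, `T r` of a matrix that is scalar exactly modulo `p ^ k`. Beyond level `k` they have a
constant value `c`: `2 * p ^ (2 * k)` if the residual form splits with distinct roots, `0`
otherwise. -/
theorem fixedPoint_identity_of_values {p e k n c : ℕ} {b t : ℕ → ℕ} (hk : k < e)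
    (hb : ∀ r < k, b r = indexB p r) (ht : ∀ r ≤ k, t r = indexT p r)
    (hn : n + 2 * b k = 2 * p ^ (2 * k) + c) (hb' : ∀ r, k < r → r < e → b r = c)
    (ht' : ∀ r, k < r → r ≤ e → t r = c) :
    n + 2 * ∑ r ∈ Finset.range e, b r = t e + 2 * ∑ r ∈ Finset.range e, t r := by
  obtain ⟨m, rfl⟩ := Nat.exists_eq_add_of_lt hk
  have hB : ∑ r ∈ Finset.range (k + m + 1), b r =
      ∑ r ∈ Finset.range k, indexB p r + b k + m * c := by
    rw [show k + m + 1 = k + 1 + m by ring, Finset.sum_range_add, Finset.sum_range_succ,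
      Finset.sum_congr rfl fun r hr => hb r (Finset.mem_range.mp hr),
      Finset.sum_congr (g := fun _ => c) rfl fun r hr => hb' (k + 1 + r) (by omega)
        (by have := Finset.mem_range.mp hr; omega), Finset.sum_const, Finset.card_range,
      smul_eq_mul]
  have hT : ∑ r ∈ Finset.range (k + m + 1), t r =
      ∑ r ∈ Finset.range (k + 1), indexT p r + m * c := by
    rw [show k + m + 1 = k + 1 + m by ring, Finset.sum_range_add,
      Finset.sum_congr rfl fun r hr => ht r (Nat.lt_succ_iff.mp (Finset.mem_range.mp hr)),
      Finset.sum_congr (g := fun _ => c) rfl fun r hr => ht' (k + 1 + r) (by omega)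
        (by have := Finset.mem_range.mp hr; omega), Finset.sum_const, Finset.card_range,
      smul_eq_mul]
  rw [hB, hT, ht' _ (by omega) le_rfl, ← sum_indexB_add_pow]
  linarith

variable {p e : ℕ} [Fact p.Prime]

theorem char_perm (H : Subgroup (G p e)) (g : G p e) :
    (perm H).character g = Nat.card (MulAction.fixedBy (G p e ⧸ H) g) :=
  Representation.char_ofMulAction g

instance (H : Subgroup (G p e)) : FiniteDimensional ℚ (ℚ[G p e ⧸ H]) :=
  Module.Finite.equiv (MonoidAlgebra.coeffLinearEquiv ℚ).symm

theorem char_perm2 (H : Subgroup (G p e)) (g : G p e) :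
    (perm2 H).character g = 2 * Nat.card (MulAction.fixedBy (G p e ⧸ H) g) := by
  rw [Representation.char_prod, char_perm, two_mul]

/-- The largest power `p ^ k` modulo which `g` is scalar. -/
theorem exists_maximal_isMulForm (g : G p e) : ∃ k ≤ e, (∃ A B C, IsMulForm g k A B C) ∧
    (k < e → ¬ ∃ A B C, IsMulForm g (k + 1) A B C) := by
  classical
  refine ⟨Nat.findGreatest (fun k => ∃ A B C, IsMulForm g k A B C) e, Nat.findGreatest_le e,
    Nat.findGreatest_spec (P := fun k => ∃ A B C, IsMulForm g k A B C) (Nat.zero_le e)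
      ⟨_, _, _, isMulForm_zero g⟩, fun hk => ?_⟩
  exact Nat.findGreatest_is_greatest (Nat.lt_succ_self _) hk

variable [NeZero e]

/-- Classification of the reduction modulo `p` of the residual form: up to conjugation it is
anisotropic, or a product of two distinct linear forms, or the square of a linear form. -/
theorem exists_conj_isMulForm {g : G p e} {k : ℕ} {A B C : ZMod (p ^ e)}
    (h : IsMulForm g k A B C) (hg : ¬ ∃ A B C, IsMulForm g (k + 1) A B C) :
    (∀ s t, (p : ZMod (p ^ e)) ∣ binForm A B C s t →
      (p : ZMod (p ^ e)) ∣ s ∧ (p : ZMod (p ^ e)) ∣ t) ∨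
    (∃ (x : G p e) (A' B' C' : ZMod (p ^ e)), IsUnit B' ∧
      IsMulForm (x⁻¹ * g * x) k (p * A') B' (p * C')) ∨
    (∃ (x : G p e) (A' B' C' : ZMod (p ^ e)), IsUnit C' ∧
      IsMulForm (x⁻¹ * g * x) k (p * A') (p * B') C') := by
  refine or_iff_not_imp_left.mpr fun hiso => ?_
  push Not at hiso
  obtain ⟨s, t, hst, hnot⟩ := hiso
  obtain ⟨x, rfl, rfl⟩ := exists_first_col (p := p) (fun hd => hnot hd.1 hd.2)
  obtain ⟨w, hw⟩ := h.conj x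
  rw [← exists_isMulForm_conj_iff g x] at hg
  obtain ⟨A', hA'⟩ := hst.mul_left w.val
  rw [hA'] at hw
  generalize w.val * binPolar A B C _ _ _ _ = B' at hw
  generalize w.val * binForm A B C _ _ = C' at hw
  by_cases hB : (p : ZMod (p ^ e)) ∣ B'
  · obtain ⟨B'', rfl⟩ := hB
    refine Or.inr ⟨x, A', B'', C', ?_, hw⟩
    rw [isUnit_iff_not_dvd]
    rintro ⟨C'', rfl⟩
    obtain ⟨h1, h2, h3⟩ := hw
    exact hg ⟨A', B'', C'', by rw [h1]; ring, by rw [h2]; ring, by rw [h3]; ring⟩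
  · rw [← isUnit_iff_not_dvd] at hB
    obtain ⟨u, rfl⟩ := hB
    have hu : u.val * (u⁻¹).val = 1 := u.mul_inv
    -- The second root modulo `p` of the form is `(-C' / B', 1)`.
    let y : G p e := Matrix.GeneralLinearGroup.mk'' !![1, -C' * (u⁻¹).val; 0, 1] (by simp)
    have hy : y.val = !![1, -C' * (u⁻¹).val; 0, 1] := rfl
    obtain ⟨v, hv⟩ := hw.conj y
    have hxy : y⁻¹ * (x⁻¹ * g * x) * y = (x * y)⁻¹ * g * (x * y) := by group
    rw [hxy, hy] at hv
    have h1 : v.val * binForm (p * A') u.val C' 1 0 = p * (v.val * A') := by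
      rw [binForm]
      ring
    have h2 : v.val * binForm (p * A') u.val C' (-C' * (u⁻¹).val) 1 =
        p * (v.val * A' * (C' * (u⁻¹).val) ^ 2) := by
      rw [binForm]
      linear_combination (-v.val * C') * hu
    refine Or.inl ⟨x * y, v.val * A', v.val * binPolar (p * A') u.val C' 1 0 (-C' * (u⁻¹).val) 1,
      v.val * A' * (C' * (u⁻¹).val) ^ 2, v.isUnit.mul ?_, ?_⟩
    · rw [isUnit_iff_not_dvd, binPolar]
      intro hd
      refine (isUnit_iff_not_dvd _).mp u.isUnit ?_
      have h3 : (p : ZMod (p ^ e)) ∣ p * (2 * A' * (-C' * (u⁻¹).val)) := dvd_mul_right _ _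
      convert dvd_sub hd h3 using 1
      ring
    · rw [← h1, ← h2]
      exact hv

/-- The equality of permutation characters: fixed points of every `g` are counted according to the
level `k` up to which `g` is scalar and the type of the residual form. -/
theorem fixedPoint_identity {ξ : (ZMod (p ^ e))ˣ} (hξ : p ≠ 2 → ¬ IsSquare (ξ : ZMod (p ^ e)))
    (g : G p e) :
    Nat.card (MulAction.fixedBy (G p e ⧸ Cns p e ξ) g) +
        2 * ∑ r ∈ Finset.range e, Nat.card (MulAction.fixedBy (G p e ⧸ B p e r) g) =
      Nat.card (MulAction.fixedBy (G p e ⧸ Cs p e) g) +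
        2 * ∑ r ∈ Finset.range e, Nat.card (MulAction.fixedBy (G p e ⧸ T p e r) g) := by
  rw [Cs_eq_T]
  obtain ⟨k, hke, ⟨a, b, c, h⟩, hmax⟩ := exists_maximal_isMulForm g
  rcases hke.eq_or_lt with rfl | hk
  -- If `g` is scalar, the identity is one between the indices of the subgroups.
  · have hn := card_fixedBy_Cns_of_scalar hξ h
    have hsum := sum_indexB_add_pow p k
    rw [Finset.sum_congr rfl fun r hr => card_fixedBy_B_of_lt h (Finset.mem_range.mp hr) le_rfl,
      Finset.sum_congr rfl fun r hr => card_fixedBy_T_of_le h (Finset.mem_range.mp hr).le le_rfl,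
      card_fixedBy_T_of_le h le_rfl le_rfl, hn]
    rw [Finset.sum_range_succ] at hsum
    have key : p ^ k * (p ^ (k - 1) * (p - 1)) + indexT p k = 2 * p ^ (2 * k) := by
      obtain ⟨m, rfl⟩ := Nat.exists_eq_succ_of_ne_zero (NeZero.ne k)
      obtain ⟨q, hq⟩ := Nat.exists_eq_succ_of_ne_zero (Fact.out : p.Prime).ne_zero
      rw [hq, indexT, Nat.succ_sub_one, Nat.succ_sub_one, Nat.succ_eq_add_one, Nat.succ_eq_add_one]
      ring
    linarith
  · have conj := fun (H : Subgroup (G p e)) (x : G p e) =>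
      H.card_fixedBy_quotient_conj g x
    rcases exists_conj_isMulForm h (hmax hk) with
      hF | ⟨x, A', B', C', hB', h'⟩ | ⟨x, A', B', C', hC', h'⟩
    · refine fixedPoint_identity_of_values (c := 0) hk
        (fun r hr => card_fixedBy_B_of_lt h hr hke) (fun r hr => card_fixedBy_T_of_le h hr hke) ?_
        (fun r hr hr' => card_fixedBy_B_of_anisotropic h hF hr.le hr')
        (fun r hr hr' => card_fixedBy_T_of_anisotropic h hF hr hr')
      rw [card_fixedBy_Cns_of_anisotropic hξ hk h hF,
        card_fixedBy_B_of_anisotropic h hF le_rfl hk]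
    · refine fixedPoint_identity_of_values (c := 2 * p ^ (2 * k)) hk
        (fun r hr => card_fixedBy_B_of_lt h hr hke) (fun r hr => card_fixedBy_T_of_le h hr hke) ?_
        (fun r hr hr' => (conj _ x).symm.trans (card_fixedBy_B_of_split h' hB' hr.le hr'))
        (fun r hr hr' => (conj _ x).symm.trans (card_fixedBy_T_of_split h' hB' hr hr'))
      rw [← conj _ x, ← conj _ x, card_fixedBy_B_of_split h' hB' le_rfl hk,
        card_fixedBy_Cns_eq_zero hξ hk h' (dvd_mul_right _ _)
          (mt (exists_isMulForm_conj_iff g x (k + 1)).mp (hmax hk))]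
      ring
    · refine fixedPoint_identity_of_values (c := 0) hk
        (fun r hr => card_fixedBy_B_of_lt h hr hke) (fun r hr => card_fixedBy_T_of_le h hr hke) ?_
        (fun r hr hr' => (conj _ x).symm.trans (card_fixedBy_B_of_ramified_of_lt h' hC' hr hr'))
        (fun r hr hr' => (conj _ x).symm.trans (card_fixedBy_T_of_ramified h' hC' hr hr'))
      rw [← conj _ x, ← conj _ x, card_fixedBy_B_of_ramified h' hC' hk,
        card_fixedBy_Cns_eq_zero hξ hk h' (dvd_mul_right _ _)
          (mt (exists_isMulForm_conj_iff g x (k + 1)).mp (hmax hk))]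
      ring

end

end CartanChen

theorem mainTheorem11 (p e : ℕ) [Fact p.Prime] [NeZero e] (ξ : (ZMod (p ^ e))ˣ)
    (hξ : p ≠ 2 → ¬ IsSquare (ξ : ZMod (p ^ e))) :
    Nonempty (Representation.Equiv
      ((CartanChen.perm (CartanChen.Cns p e ξ)).prod
        (Representation.directSum fun r : Fin e => CartanChen.perm2 (CartanChen.B p e r)))
      ((CartanChen.perm (CartanChen.Cs p e)).prod
        (Representation.directSum fun r : Fin e => CartanChen.perm2 (CartanChen.T p e r)))) := by
  refine Representation.nonempty_equiv_of_character_eq _ _ (funext fun g => ?_)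
  rw [Representation.char_prod, Representation.char_prod, Representation.char_directSum,
    Representation.char_directSum]
  simp only [CartanChen.char_perm, CartanChen.char_perm2]
  rw [← Finset.mul_sum, ← Finset.mul_sum,
    Fin.sum_univ_eq_sum_range fun r =>
      (Nat.card (MulAction.fixedBy (CartanChen.G p e ⧸ CartanChen.B p e r) g) : ℚ),
    Fin.sum_univ_eq_sum_range fun r =>
      (Nat.card (MulAction.fixedBy (CartanChen.G p e ⧸ CartanChen.T p e r) g) : ℚ)]
  exact_mod_cast CartanChen.fixedPoint_identity hξ g
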